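/- Let $n\ge 2$, $0\le d\le n$, and let $\widetilde G^n_d$ be the oriented Grassmannian of $d$-dimensional oriented linear subspaces of $\mathbb R^n$. An (oriented) $d$-varifold is a nonnegative finite Radon measure $\mu$ on $\mathbb R^n\times\widetilde G^n_d$; its weight $|\mu|$ is its image on $\mathbb R^n$. For a $C^1$-diffeomorphism $\varphi$ of $\mathbb R^n$, let $J_U\varphi(x)$ be the Jacobian of $\varphi$ at $x$ along $U$, that is $J_U\varphi(x)=\sqrt{\det(d_x\varphi(u_i)\cdot d_x\varphi(u_j))_{i,j}}$ for any orthonormal frame $(u_i)$ of $U$, and let $\varphi_\#\mu$ be the varifold with $\int\omega\,d(\varphi_\#\mu)=\int\omega(\varphi(x),d_x\varphi\cdot U)\,J_U\varphi(x)\,d\mu(x,U)$ for all $\omega\in C_0(\mathbb R^n\times\widetilde G^n_d)$. Let $V$ be a Hilbert space of vector fields on $\mathbb R^n$, continuously embedded in $C^2_0(\mathbb R^n,\mathbb R^n)$ (the $C^2$ vector fields that vanish at infinity with their first and second derivatives). For $v\in L^2([0,1],V)$ let $\varphi^v_t$ be its flow, $\varphi^v_t(x)=x+\int_0^t v_s(\varphi^v_s(x))\,ds$.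 For $\eta\in L^2([0,1],L^2(|\mu|))$ let $\tilde\alpha^\eta_t=1+\tfrac12\int_0^t\eta_s\,ds$ and $\mu_t=\big((\tilde\alpha^\eta_t)^2\circ(\varphi^v_t)^{-1}\big)\,(\varphi^v_t)_\#\mu$. Let $k$ be a positive definite kernel on $\mathbb R^n\times\widetilde G^n_d$ with reproducing kernel Hilbert space $W$, and put $\|\nu-\nu'\|_{W^*}=\sup_{\|\omega\|_W\le1}\big(\int\omega\,d\nu'-\int\omega\,d\nu\big)$ for varifolds $\nu,\nu'$. Assume that $k(x,U,x',U')\ge0$ and $k(x,U,x,U)>0$ for all $x,x'\in\mathbb R^n$ and $U,U'\in\widetilde G^n_d$, and that $W$ is continuously embedded in $C^1_0(\mathbb R^n\times\widetilde G^n_d)$ (the $C^1$ functions that vanish at infinity with their differential). Let $\gamma,\lambda>0$, let $\mu=\sum_{i=1}^N r_i\,\delta_{(x_i,U_i)}$ be a discrete varifold with $r_i>0$, and let $\mu'$ be any $d$-varifold. Then the problem of minimizing $$\frac12\int_0^1\|v_t\|_V^2\,dt+\frac\gamma2\int_0^1\int_{\mathbb R^n\times\widetilde G^n_d}\eta_t(x)^2\,J_U\varphi^v_t(x)\,d\mu(x,U)\,dt+\frac\lambda2\,\|\mu_1-\mu'\|_{W^*}^2$$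 over all $v\in L^2([0,1],V)$ and $\eta\in L^2([0,1],L^2(|\mu|))$ has a solution $(v,\eta)$. Moreover, there is a solution with $\tilde\alpha^\eta_t\ge0$ $|\mu|$-almost everywhere for every $t\in[0,1]$, so that it also solves the problem restricted to such $\eta$. -/

import Mathlib

open MeasureTheory Filter Topology Set

noncomputable section

/-- The ambient Euclidean space `ℝⁿ`. -/
abbrev Eucl (n : ℕ) : Type := EuclideanSpace ℝ (Fin n)

/-! ### The oriented Grassmannian -/

/-- Frames of `d` linearly independent vectors of `ℝⁿ`. -/
abbrev Frame (n d : ℕ) : Type := {u : Fin d → Eucl n // LinearIndependent ℝ u}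

/-- If `w_j = ∑ᵢ R i j • u_i`, the Gram matrix of `w` is `Rᵀ G R`, where `G` is that of `u`. -/
theorem gram_comb {n d : ℕ} (u w : Fin d → Eucl n) (R : Matrix (Fin d) (Fin d) ℝ)
    (h : ∀ j, w j = ∑ i, R i j • u i) :
    Matrix.gram ℝ w = R.transpose * Matrix.gram ℝ u * R := by
  ext a b
  simp only [Matrix.gram, Matrix.of_apply, h, Matrix.mul_apply, Matrix.transpose_apply,
    sum_inner, inner_sum, inner_smul_left, inner_smul_right, Finset.sum_mul]
  refine Finset.sum_congr rfl fun i _ => ?_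
  rw [Finset.mul_sum]
  refine Finset.sum_congr rfl fun j _ => ?_
  simp
  ring

/-- Two frames span the same oriented subspace when the change of frame has positive determinant. -/
def frameSetoid (n d : ℕ) : Setoid (Frame n d) where
  r u w := ∃ R : Matrix (Fin d) (Fin d) ℝ, 0 < R.det ∧ ∀ j, w.1 j = ∑ i, R i j • u.1 i
  iseqv :=
    { refl := fun u => ⟨1, by simp, fun j => by simp [Matrix.one_apply]⟩
      symm := by
        rintro u w ⟨R, hR, h⟩
        refine ⟨R⁻¹, by rw [Matrix.det_nonsing_inv]; simpa using hR, fun j => ?_⟩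
        have hRR : R * R⁻¹ = 1 := Matrix.mul_nonsing_inv _ (isUnit_iff_ne_zero.2 hR.ne')
        simp only [h, Finset.smul_sum, smul_smul]
        rw [Finset.sum_comm]
        have : ∀ i, ∑ k, (R⁻¹ k j * R i k) • u.1 i = (1 : Matrix (Fin d) (Fin d) ℝ) i j • u.1 i := by
          intro i
          rw [← Finset.sum_smul, ← hRR, Matrix.mul_apply]
          simp only [mul_comm]
        simp [this, Matrix.one_apply]
      trans := by
        rintro u w z ⟨R, hR, h⟩ ⟨S, hS, h'⟩
        refine ⟨R * S, by rw [Matrix.det_mul]; positivity, fun j => ?_⟩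
        simp only [h', h, Finset.smul_sum, smul_smul]
        rw [Finset.sum_comm]
        refine Finset.sum_congr rfl fun i _ => ?_
        rw [← Finset.sum_smul, Matrix.mul_apply]
        simp only [mul_comm] }

/-- The oriented Grassmannian of `d`-dimensional oriented linear subspaces of `ℝⁿ`. -/
def OGrass (n d : ℕ) : Type := Quotient (frameSetoid n d)

namespace OGrass

variable {n d : ℕ}

/-- The oriented subspace spanned by a frame. -/
def span (u : Frame n d) : OGrass n d := Quotient.mk (frameSetoid n d) u

/-- The quotient topology from the open set of frames in `(ℝⁿ)ᵈ`. -/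
instance : TopologicalSpace (OGrass n d) :=
  inferInstanceAs (TopologicalSpace (Quotient (frameSetoid n d)))

instance : MeasurableSpace (OGrass n d) := borel _

instance : BorelSpace (OGrass n d) := ⟨rfl⟩

open Classical in
/-- The image `A · U` of an oriented subspace by an injective linear map `A`, spanned by the images
of the vectors of a frame of `U` (by convention `U` itself if `A` is not injective). -/
def map (A : Eucl n →L[ℝ] Eucl n) (U : OGrass n d) : OGrass n d :=
  if hA : Function.Injective A then
    Quotient.lift (s := frameSetoid n d)
      (fun u => span ⟨fun i => A (u.1 i),
        u.2.map' (A : Eucl n →ₗ[ℝ] Eucl n) (LinearMap.ker_eq_bot.2 hA)⟩)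
      (by
        rintro u w ⟨R, hR, h⟩
        refine Quotient.sound (s := frameSetoid n d) ⟨R, hR, fun j => ?_⟩
        simp [h]) U
  else U

/-- The change of `d`-volume `J_U A` of a linear map `A` along `U`: for any frame `u` of `U`, the
ratio of the `d`-volumes of `(A u_i)` and `(u_i)`, so `√det (A u_i · A u_j)` if `u` is
orthonormal. -/
def jac (A : Eucl n →L[ℝ] Eucl n) (U : OGrass n d) : ℝ :=
  Quotient.lift (s := frameSetoid n d)
    (fun u => √((Matrix.gram ℝ fun i => A (u.1 i)).det / (Matrix.gram ℝ u.1).det))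
    (by
      rintro u w ⟨R, hR, h⟩
      have h2 : ∀ j, A (w.1 j) = ∑ i, R i j • A (u.1 i) := fun j => by simp [h]
      have hR2 : R.det ≠ 0 := hR.ne'
      simp only [gram_comb _ _ R h, gram_comb _ _ R h2, Matrix.det_mul, Matrix.det_transpose]
      congr 1
      by_cases hz : (Matrix.gram ℝ u.1).det = 0
      · simp [hz]
      · field_simp) U

end OGrass

/-! ### Varifolds -/

/-- The space `ℝⁿ × G̃` that carries the varifolds; an oriented `d`-varifold is a finite measure
on it. -/
abbrev VSpace (n d : ℕ) : Type := Eucl n × OGrass n d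

/-- The weight `|μ|` of a varifold: its image on `ℝⁿ`. -/
abbrev weight {n d : ℕ} (μ : Measure (VSpace n d)) : Measure (Eucl n) := μ.map Prod.fst

/-- The discrete varifold `∑ᵢ rᵢ δ_(xᵢ, Uᵢ)`. -/
def discreteVarifold {n d N : ℕ} (r : Fin N → ℝ) (x : Fin N → Eucl n) (U : Fin N → OGrass n d) :
    Measure (VSpace n d) :=
  ∑ i, ENNReal.ofReal (r i) • Measure.dirac (x i, U i)

/-- The rescaled varifold `α μ`. -/
def rescale {n d : ℕ} (α : Eucl n → ℝ) (μ : Measure (VSpace n d)) : Measure (VSpace n d) :=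
  μ.withDensity fun p => ENNReal.ofReal (α p.1)

/-- The pushforward `φ_# μ` of a varifold: `(φ_# μ | ω) = ∫ ω(φ x, d_xφ · U) J_U φ(x) dμ(x, U)`. -/
def varifoldPush {n d : ℕ} (φ : Eucl n → Eucl n) (μ : Measure (VSpace n d)) :
    Measure (VSpace n d) :=
  (μ.withDensity fun p => ENNReal.ofReal (OGrass.jac (fderiv ℝ φ p.1) p.2)).map
    fun p => (φ p.1, OGrass.map (fderiv ℝ φ p.1) p.2)

/-- The action `(φ, α) · μ = φ_# (α μ) = (α ∘ φ⁻¹) φ_# μ`. -/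
def metaAction {n d : ℕ} (φ : Eucl n → Eucl n) (α : Eucl n → ℝ) (μ : Measure (VSpace n d)) :
    Measure (VSpace n d) :=
  varifoldPush φ (rescale α μ)

/-! ### Deformations and weight changes -/

/-- The space `L²([0,1], H)`. -/
abbrev L2Time (H : Type*) [NormedAddCommGroup H] : Type _ :=
  Lp H 2 (volume.restrict (Icc (0 : ℝ) 1))

/-- The Hilbert space `V` of vector fields is continuously embedded in `C₀²(ℝⁿ, ℝⁿ)`, the `C²`
vector fields that vanish at infinity with their first and second derivatives. -/
def EmbedsC20 {n : ℕ} (V : Type*) [NormedAddCommGroup V] [InnerProductSpace ℝ V]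
    [RKHS ℝ V (Eucl n) (Eucl n)] : Prop :=
  (∀ u : V, ContDiff ℝ 2 (u : Eucl n → Eucl n) ∧ ∀ j : ℕ, j ≤ 2 →
    Tendsto (fun x => iteratedFDeriv ℝ j (u : Eucl n → Eucl n) x) (cocompact (Eucl n)) (𝓝 0)) ∧
  ∃ c : ℝ, ∀ u : V, ∀ j : ℕ, j ≤ 2 → ∀ x : Eucl n,
    ‖iteratedFDeriv ℝ j (u : Eucl n → Eucl n) x‖ ≤ c * ‖u‖

/-- `φ` is a flow of `v` on `[0,1]`: `φ_t(x) = x + ∫₀ᵗ v_s(φ_s(x)) ds`. -/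
def IsFlow {n : ℕ} {V : Type*} [NormedAddCommGroup V] [InnerProductSpace ℝ V]
    [RKHS ℝ V (Eucl n) (Eucl n)] (v : ℝ → V) (φ : ℝ → Eucl n → Eucl n) : Prop :=
  ∀ x, ContinuousOn (fun t => φ t x) (Icc 0 1) ∧
    ∀ t ∈ Icc (0 : ℝ) 1, φ t x = x + ∫ s in (0 : ℝ)..t, v s (φ s x)

open Classical in
/-- The flow map `φ^v` of `v`, which exists and is unique on `[0,1]` when `v` is in `L²([0,1], V)`
and `V` is embedded in `C₀²` (by convention the identity if there is none). -/
def flowMap {n : ℕ} {V : Type*} [NormedAddCommGroup V] [InnerProductSpace ℝ V]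
    [RKHS ℝ V (Eucl n) (Eucl n)] (v : ℝ → V) : ℝ → Eucl n → Eucl n :=
  if h : ∃ φ, IsFlow v φ then h.choose else fun _ x => x

/-- `α̃_t = 1 + ½ ∫₀ᵗ η_s ds`, the integral being taken in `L²(ρ)`. -/
def alphaTilde {n : ℕ} {ρ : Measure (Eucl n)} (η : L2Time (Lp ℝ 2 ρ)) (t : ℝ) (x : Eucl n) : ℝ :=
  1 + (1 / 2) * (∫ s in (0 : ℝ)..t, η s : Lp ℝ 2 ρ) x

/-- The transformed varifold `μ_t = ((α̃_t)² ∘ (φ_t^v)⁻¹) (φ_t^v)_# μ`. -/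
def transported {n d : ℕ} {V : Type*} [NormedAddCommGroup V] [InnerProductSpace ℝ V]
    [RKHS ℝ V (Eucl n) (Eucl n)] (μ : Measure (VSpace n d)) (v : L2Time V)
    (η : L2Time (Lp ℝ 2 (weight μ))) (t : ℝ) : Measure (VSpace n d) :=
  metaAction (flowMap (v : ℝ → V) t) (fun x => alphaTilde η t x ^ 2) μ

/-! ### Kernel metrics -/

open Classical in
/-- The function `(x, u) ↦ ω(x, span u)` on the open subset `ℝⁿ × {frames}` of `ℝⁿ × (ℝⁿ)ᵈ`, extended
by `0`. -/
def frameLift {n d : ℕ} (ω : VSpace n d → ℝ) (p : Eucl n × (Fin d → Eucl n)) : ℝ :=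
  if h : LinearIndependent ℝ p.2 then ω (p.1, OGrass.span ⟨p.2, h⟩) else 0

/-- `W` is continuously embedded in `C₀¹(ℝⁿ × G̃)`: its elements are `C¹`, vanish at infinity with
their differential, and their `C¹` sup-norm is bounded by a constant times their norm in `W`.

Since `u ↦ span u` is a submersion from the frames onto `G̃`, being `C¹` is read on the lift to
frames. The lift is constant along the fibres, whose tangent space at an orthonormal frame `u`
is orthogonal to the horizontal space `{h | h_i ⟂ span u}`, the tangent space of `G̃` with its
metric; so, up to the choice of equivalent norms on `(ℝⁿ)ᵈ`, the derivative of the lift at `(x, u)`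
has the norm of the differential of `ω` at `(x, span u)`. -/
def EmbedsC10 {n d : ℕ} (W : Type*) [NormedAddCommGroup W] [InnerProductSpace ℝ W]
    [RKHS ℝ W (VSpace n d) ℝ] : Prop :=
  (∀ ω : W,
    ContDiffOn ℝ 1 (frameLift (ω : VSpace n d → ℝ)) {p | LinearIndependent ℝ p.2} ∧
    ∀ ε : ℝ, 0 < ε → ∃ M : ℝ, ∀ x : Eucl n, M < ‖x‖ →
      (∀ U : OGrass n d, |ω (x, U)| < ε) ∧
      ∀ u : Fin d → Eucl n, Orthonormal ℝ u →
        ‖fderiv ℝ (frameLift (ω : VSpace n d → ℝ)) (x, u)‖ < ε) ∧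
  ∃ c : ℝ, ∀ ω : W, ∀ x : Eucl n,
    (∀ U : OGrass n d, |ω (x, U)| ≤ c * ‖ω‖) ∧
    ∀ u : Fin d → Eucl n, Orthonormal ℝ u →
      ‖fderiv ℝ (frameLift (ω : VSpace n d → ℝ)) (x, u)‖ ≤ c * ‖ω‖

/-- The dual distance `‖μ' - μ‖_{W*} = sup {(μ' - μ | ω) : ‖ω‖_W ≤ 1}`. -/
def dualDist {n d : ℕ} (W : Type*) [NormedAddCommGroup W] [InnerProductSpace ℝ W]
    [RKHS ℝ W (VSpace n d) ℝ] (μ μ' : Measure (VSpace n d)) : ℝ :=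
  ⨆ ω : {ω : W // ‖ω‖ ≤ 1}, ((∫ z, ω.1 z ∂μ') - ∫ z, ω.1 z ∂μ)

/-- The relaxed LDDMM-Fisher-Rao functional. -/
def relaxedCost {n d : ℕ} {V : Type*} [NormedAddCommGroup V] [InnerProductSpace ℝ V]
    [RKHS ℝ V (Eucl n) (Eucl n)] (W : Type*) [NormedAddCommGroup W] [InnerProductSpace ℝ W]
    [RKHS ℝ W (VSpace n d) ℝ] (γ lam : ℝ) (μ μtar : Measure (VSpace n d))
    (v : L2Time V) (η : L2Time (Lp ℝ 2 (weight μ))) : ℝ :=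
  1 / 2 * (∫ t in (0 : ℝ)..1, ‖v t‖ ^ 2) +
  γ / 2 * (∫ t in (0 : ℝ)..1, ∫ p,
    (η t : Eucl n → ℝ) p.1 ^ 2 *
      OGrass.jac (fderiv ℝ (flowMap (v : ℝ → V) t) p.1) p.2 ∂μ) +
  lam / 2 * dualDist W (transported μ v η 1) μtar ^ 2

end

/-!
For fixed `v` and a fixed final value `β` of `α̃`, the varifold `μ₁` does not depend on the rest of
`η`. If `J_t` denotes the mass at the image of an atom of `|μ|` under `φ_t^v`, the Cauchy–Schwarz
inequality bounds the weight term at this atom below by `2γ (β - 1)² / ∫₀¹ dt / J_t`, with equality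
when `η_t` is proportional to `1 / J_t`; then `α̃` moves monotonically from `1` to `β`. This reduces
the problem to the pairs `(v, β)`, with finitely many numbers `β`. As `μ₁` involves only `β²`,
replacing `β` by `|β|` does not increase the cost, which gives nonnegative optimal weights.

The reduced problem is solved by the direct method. Along a minimizing sequence the norms of `v`
and the numbers `β` are bounded, so that they converge along an ultrafilter, weakly for `v`. Weak
convergence of `v` implies uniform convergence in time of the flow and of its differential at each
atom, hence convergence of `∫ ω dμ₁` for every `ω` in `W` and of the weight terms, while the norm
and the dual distance are lower semicontinuous.
-/

noncomputable section

/-! ### Square integrable functions of time -/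

theorem sq_integral_mul_le {X : Type*} [MeasurableSpace X] {ν : Measure X} {f g : X → ℝ}
    (hf : MemLp f 2 ν) (hg : MemLp g 2 ν) :
    (∫ x, f x * g x ∂ν) ^ 2 ≤ (∫ x, f x ^ 2 ∂ν) * ∫ x, g x ^ 2 ∂ν := by
  have inner_eq {f g : X → ℝ} (hf : MemLp f 2 ν) (hg : MemLp g 2 ν) :
      inner ℝ (hf.toLp f) (hg.toLp g) = ∫ x, f x * g x ∂ν := by
    rw [L2.inner_def]
    refine integral_congr_ae ?_
    filter_upwards [hf.coeFn_toLp, hg.coeFn_toLp] with x hfx hgx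
    simp [hfx, hgx, mul_comm]
  simpa only [inner_eq, ← pow_two] using
    real_inner_mul_inner_self_le (hf.toLp f) (hg.toLp g)

theorem intervalIntegrable_of_mem_Icc {F : Type*} [NormedAddCommGroup F] {f : ℝ → F} {a b s t : ℝ}
    (hf : IntegrableOn f (Icc a b)) (hs : s ∈ Icc a b) (ht : t ∈ Icc a b) :
    IntervalIntegrable f volume s t :=
  (hf.mono_set (uIcc_subset_Icc hs ht)).intervalIntegrable

namespace L2Time

section Norm

variable {H : Type*} [NormedAddCommGroup H] (v : L2Time H)

theorem memLp_norm : MemLp (fun s => ‖v s‖) 2 (volume.restrict (Icc (0 : ℝ) 1)) :=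
  (Lp.memLp v).norm

theorem integrableOn_norm : IntegrableOn (fun s => ‖v s‖) (Icc (0 : ℝ) 1) :=
  (memLp_norm v).integrable one_le_two

theorem intervalIntegrable_norm_mul {f : ℝ → ℝ} (hf : ContinuousOn f (Icc 0 1)) {s t : ℝ}
    (hs : s ∈ Icc (0 : ℝ) 1) (ht : t ∈ Icc (0 : ℝ) 1) :
    IntervalIntegrable (fun s => ‖v s‖ * f s) volume s t :=
  intervalIntegrable_of_mem_Icc ((integrableOn_norm v).mul_continuousOn hf isCompact_Icc) hs ht

theorem integral_sq_norm : ∫ s in (0 : ℝ)..1, ‖v s‖ ^ 2 = ‖v‖ ^ 2 := by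
  have hnorm : ‖v‖ = (∫ s in Icc (0 : ℝ) 1, ‖v s‖ ^ 2) ^ (2⁻¹ : ℝ) := by
    rw [Lp.norm_def, (Lp.memLp v).eLpNorm_eq_integral_rpow_norm two_ne_zero ENNReal.ofNat_ne_top,
      ENNReal.toReal_ofReal (by positivity)]
    simp
  rw [intervalIntegral.integral_of_le zero_le_one, ← integral_Icc_eq_integral_Ioc, hnorm,
    ← Real.rpow_mul_natCast (integral_nonneg fun _ => sq_nonneg _)]
  norm_num

theorem sq_integral_norm_mul_le {f : ℝ → ℝ} (hf : ContinuousOn f (Icc 0 1)) {s t : ℝ}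
    (hs : 0 ≤ s) (hst : s ≤ t) (ht : t ≤ 1) :
    (∫ r in s..t, ‖v r‖ * f r) ^ 2 ≤ ‖v‖ ^ 2 * ∫ r in s..t, f r ^ 2 := by
  have hsub : Ioc s t ⊆ Icc 0 1 := fun r hr => ⟨hs.trans hr.1.le, hr.2.trans ht⟩
  have hle : volume.restrict (Ioc s t) ≤ volume.restrict (Icc (0 : ℝ) 1) :=
    Measure.restrict_mono hsub le_rfl
  have hf2 : MemLp f 2 (volume.restrict (Icc (0 : ℝ) 1)) := by
    obtain ⟨B, hB⟩ := isCompact_Icc.exists_bound_of_continuousOn hf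
    exact MemLp.of_bound (hf.aestronglyMeasurable measurableSet_Icc) B
      ((ae_restrict_iff' measurableSet_Icc).2 (ae_of_all _ hB))
  have hnorm : ∫ r in Ioc s t, ‖v r‖ ^ 2 ≤ ‖v‖ ^ 2 := by
    rw [← integral_sq_norm, intervalIntegral.integral_of_le zero_le_one,
      ← integral_Icc_eq_integral_Ioc (x := 0)]
    exact integral_mono_measure hle (ae_of_all _ fun _ => sq_nonneg _)
      (memLp_norm v).integrable_sq
  rw [intervalIntegral.integral_of_le hst, intervalIntegral.integral_of_le hst]
  exact (sq_integral_mul_le ((memLp_norm v).mono_measure hle) (hf2.mono_measure hle)).trans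
    (mul_le_mul_of_nonneg_right hnorm (integral_nonneg fun _ => sq_nonneg _))

theorem integral_norm_le {s t : ℝ} (hs : 0 ≤ s) (hst : s ≤ t) (ht : t ≤ 1) :
    ∫ r in s..t, ‖v r‖ ≤ ‖v‖ * √(t - s) := by
  have h := sq_integral_norm_mul_le v (f := fun _ => 1) continuousOn_const hs hst ht
  simp only [mul_one, one_pow, intervalIntegral.integral_const, smul_eq_mul] at h
  refine (le_abs_self _).trans (abs_le_of_sq_le_sq ?_ (by positivity))
  rwa [mul_pow, Real.sq_sqrt (sub_nonneg.2 hst)]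

end Norm

end L2Time

/-! ### Grönwall inequalities -/

theorem le_mul_exp_of_le_add_integral {g : ℝ → ℝ} {T A B : ℝ} (hg : ContinuousOn g (Icc 0 T))
    (hB : 0 ≤ B) (h : ∀ t ∈ Icc 0 T, g t ≤ A + B * ∫ s in (0 : ℝ)..t, g s) :
    ∀ t ∈ Icc 0 T, g t ≤ A * Real.exp (B * t) := by
  intro t ht
  have hT : 0 ≤ T := ht.1.trans ht.2
  have hgi : IntegrableOn g (uIcc 0 T) := by
    rw [uIcc_of_le hT]
    exact hg.integrableOn_Icc
  have hcont : ContinuousOn (fun t => A + B * ∫ s in (0 : ℝ)..t, g s) (Icc 0 T) := by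
    have := intervalIntegral.continuousOn_primitive_interval (μ := volume) hgi
    rw [uIcc_of_le hT] at this
    exact continuousOn_const.add (continuousOn_const.mul this)
  have hderiv : ∀ s ∈ Ico 0 T,
      HasDerivWithinAt (fun t => A + B * ∫ s in (0 : ℝ)..t, g s) (B * g s) (Ici s) s := by
    intro s hs
    have hnhds : Icc 0 T ∈ 𝓝[>] s :=
      mem_of_superset (Icc_mem_nhdsGT hs.2) (Icc_subset_Icc_left hs.1)
    refine ((intervalIntegral.integral_hasDerivWithinAt_right ?_ ?_
      ?_).const_mul B).const_add A
    · exact (hgi.mono_set (uIcc_subset_uIcc_left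
        (by rw [uIcc_of_le hT]; exact Ico_subset_Icc_self hs))).intervalIntegrable
    · exact ⟨Icc 0 T, hnhds, hg.aestronglyMeasurable measurableSet_Icc⟩
    · exact (hg s (Ico_subset_Icc_self hs)).mono_of_mem_nhdsWithin hnhds
  have := le_gronwallBound_of_liminf_deriv_right_le (δ := A) (K := B) (ε := 0) hcont
    (fun s hs _ hr => (hderiv s hs).liminf_right_slope_le hr) (by simp) (fun s hs => by
      simpa using mul_le_mul_of_nonneg_left (h s (Ico_subset_Icc_self hs)) hB) t ht
  rw [gronwallBound_ε0, sub_zero] at this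
  exact (h t ht).trans this

theorem eq_zero_of_le_integral_right {g : ℝ → ℝ} {T B : ℝ} (hg : ContinuousOn g (Icc 0 T))
    (hg0 : ∀ t ∈ Icc 0 T, 0 ≤ g t) (hB : 0 ≤ B)
    (h : ∀ t ∈ Icc 0 T, g t ≤ B * ∫ s in t..T, g s) {t : ℝ} (ht : t ∈ Icc 0 T) : g t = 0 := by
  have hmaps : MapsTo (fun s => T - s) (Icc 0 T) (Icc 0 T) := fun s hs => by
    constructor <;> linarith [hs.1, hs.2]
  have := le_mul_exp_of_le_add_integral (A := 0) (hg.comp (by fun_prop) hmaps) hB (fun s hs => by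
    simpa [intervalIntegral.integral_comp_sub_left g T] using h _ (hmaps hs)) _ (hmaps ht)
  exact le_antisymm (by simpa using this) (hg0 t ht)

theorem L2Time.gronwall {H : Type*} [NormedAddCommGroup H] (v : L2Time H) {f : ℝ → ℝ}
    (hf : ContinuousOn f (Icc 0 1)) (hf0 : ∀ t ∈ Icc (0 : ℝ) 1, 0 ≤ f t) {a K : ℝ} (ha : 0 ≤ a)
    (h : ∀ t ∈ Icc (0 : ℝ) 1, f t ≤ a + K * ∫ s in (0 : ℝ)..t, ‖v s‖ * f s) :
    ∀ t ∈ Icc (0 : ℝ) 1, f t ≤ a * (2 * Real.exp ((K * ‖v‖) ^ 2)) := by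
  intro t ht
  -- The rate `‖v s‖` is only square integrable, so the inequality is squared first.
  have hsq : f t ^ 2 ≤ 2 * a ^ 2 * Real.exp (2 * (K * ‖v‖) ^ 2 * t) := by
    refine le_mul_exp_of_le_add_integral (g := fun s => f s ^ 2) (hf.pow 2) (by positivity)
      (fun s hs => ?_) t ht
    have hCS := mul_le_mul_of_nonneg_left (v.sq_integral_norm_mul_le hf le_rfl hs.1 hs.2)
      (sq_nonneg K)
    have := pow_le_pow_left₀ (hf0 s hs) (h s hs) 2
    nlinarith [sq_nonneg (a - K * ∫ r in (0 : ℝ)..s, ‖v r‖ * f r)]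
  refine (le_abs_self _).trans (abs_le_of_sq_le_sq (hsq.trans ?_) (by positivity))
  have hexp : Real.exp (2 * (K * ‖v‖) ^ 2 * t) ≤ Real.exp (2 * (K * ‖v‖) ^ 2) :=
    Real.exp_le_exp.2 (mul_le_of_le_one_right (by positivity) ht.2)
  calc 2 * a ^ 2 * Real.exp (2 * (K * ‖v‖) ^ 2 * t)
      ≤ 2 ^ 2 * a ^ 2 * Real.exp (2 * (K * ‖v‖) ^ 2) := by
        gcongr
        norm_num
    _ = (a * (2 * Real.exp ((K * ‖v‖) ^ 2))) ^ 2 := by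
        have : Real.exp (2 * (K * ‖v‖) ^ 2) = Real.exp ((K * ‖v‖) ^ 2) ^ 2 := by
          rw [← Real.exp_nat_mul, Nat.cast_ofNat]
        rw [this]
        ring

theorem L2Time.gronwall_add {H : Type*} [NormedAddCommGroup H] (v : L2Time H) {f : ℝ → ℝ}
    (hf : ContinuousOn f (Icc 0 1)) (hf0 : ∀ t ∈ Icc (0 : ℝ) 1, 0 ≤ f t) {a δ K : ℝ} (ha : 0 ≤ a)
    (hδ : 0 ≤ δ)
    (h : ∀ t ∈ Icc (0 : ℝ) 1, f t ≤ a + ∫ s in (0 : ℝ)..t, ‖v s‖ * (K * f s + δ)) :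
    ∀ t ∈ Icc (0 : ℝ) 1, f t ≤ (a + δ * ‖v‖) * (2 * Real.exp ((K * ‖v‖) ^ 2)) := by
  refine v.gronwall hf hf0 (by positivity) fun t ht => ?_
  have h0 : (0 : ℝ) ∈ Icc (0 : ℝ) 1 := left_mem_Icc.2 zero_le_one
  have hsplit : ∫ s in (0 : ℝ)..t, ‖v s‖ * (K * f s + δ) =
      K * (∫ s in (0 : ℝ)..t, ‖v s‖ * f s) + δ * ∫ s in (0 : ℝ)..t, ‖v s‖ := by
    rw [← intervalIntegral.integral_const_mul, ← intervalIntegral.integral_const_mul,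
      ← intervalIntegral.integral_add ((v.intervalIntegrable_norm_mul hf h0 ht).const_mul K)
        ((intervalIntegrable_of_mem_Icc v.integrableOn_norm h0 ht).const_mul δ)]
    exact intervalIntegral.integral_congr fun s _ => by ring
  have hnorm : ∫ s in (0 : ℝ)..t, ‖v s‖ ≤ ‖v‖ :=
    (v.integral_norm_le le_rfl ht.1 ht.2).trans (mul_le_of_le_one_right (norm_nonneg _)
      (Real.sqrt_le_one.2 (by linarith [ht.2])))
  linarith [h t ht, mul_le_mul_of_nonneg_left hnorm hδ]

/-! ### Weak convergence -/

section Weak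

variable {ι E F : Type*} [NormedAddCommGroup E] [NormedSpace ℝ E] [NormedAddCommGroup F]
  [NormedSpace ℝ F] {l : Filter ι} {u : ι → E} {v : E}

/-- Weak convergence of a family in a normed space: convergence against all continuous linear
forms. -/
def TendstoWeakly (u : ι → E) (l : Filter ι) (v : E) : Prop :=
  ∀ T : E →L[ℝ] ℝ, Tendsto (fun i => T (u i)) l (𝓝 (T v))

namespace TendstoWeakly

theorem tendsto_apply [FiniteDimensional ℝ F] (h : TendstoWeakly u l v) (T : E →L[ℝ] F) :
    Tendsto (fun i => T (u i)) l (𝓝 (T v)) := by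
  let e : F ≃L[ℝ] (Fin (Module.finrank ℝ F) → ℝ) := (Module.finBasis ℝ F).equivFunL
  have he : Tendsto (fun i => e (T (u i))) l (𝓝 (e (T v))) := tendsto_pi_nhds.2 fun j =>
    h ((ContinuousLinearMap.proj j).comp ((e : F →L[ℝ] (Fin (Module.finrank ℝ F) → ℝ)).comp T))
  simpa [Function.comp_def] using (e.symm.continuous.tendsto _).comp he

theorem norm_le [l.NeBot] (h : TendstoWeakly u l v) {p : ℝ}
    (hp : Tendsto (fun i => ‖u i‖) l (𝓝 p)) : ‖v‖ ≤ p := by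
  obtain ⟨T, hT, hTv⟩ := exists_dual_vector'' ℝ v
  have hTv' : T v ≤ p := le_of_tendsto_of_tendsto' (h T) hp fun i =>
    (le_abs_self _).trans ((T.le_of_opNorm_le hT _).trans_eq (one_mul _))
  simpa [hTv] using hTv'

end TendstoWeakly

theorem exists_tendstoWeakly {H : Type*} [NormedAddCommGroup H] [InnerProductSpace ℝ H]
    [CompleteSpace H] (l : Ultrafilter ι) {u : ι → H} {M : ℝ} (hM : ∀ i, ‖u i‖ ≤ M) :
    ∃ v : H, TendstoWeakly u l v := by
  let dual : H ≃ₗᵢ[ℝ] StrongDual ℝ H := InnerProductSpace.toDual ℝ H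
  obtain ⟨φ, -, hφ⟩ := (WeakDual.isCompact_closedBall (0 : StrongDual ℝ H) M).ultrafilter_le_nhds'
    (l.map fun i => StrongDual.toWeakDual (dual (u i)))
    (Ultrafilter.mem_map.2 (univ_mem' fun i => by simpa [dual] using hM i))
  refine ⟨dual.symm (WeakDual.toStrongDual φ), fun T => ?_⟩
  have hswap (w : H) : T w = dual w (dual.symm T) := by
    rw [InnerProductSpace.toDual_apply_apply, real_inner_comm, InnerProductSpace.toDual_symm_apply]
  simp only [hswap, LinearIsometryEquiv.apply_symm_apply]
  exact ((WeakDual.eval_continuous (dual.symm T)).tendsto φ).comp hφ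

end Weak

/-! ### Differential equations controlled by a square integrable path -/

namespace L2Time

variable {V E : Type*} [NormedAddCommGroup V] [NormedSpace ℝ V] [NormedAddCommGroup E]
  [NormedSpace ℝ E] {P : ℝ → V →L[ℝ] E}

theorem integrableOn_apply (v : L2Time V) (hP : ContinuousOn P (Icc 0 1)) :
    IntegrableOn (fun s => P s (v s)) (Icc (0 : ℝ) 1) := by
  obtain ⟨B, hB⟩ := isCompact_Icc.exists_bound_of_continuousOn hP
  refine Integrable.mono' ((integrableOn_norm v).const_mul B) ?_ ?_
  · exact (ContinuousLinearMap.id ℝ (V →L[ℝ] E)).aestronglyMeasurable_comp₂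
      (hP.aestronglyMeasurable measurableSet_Icc) (Lp.aestronglyMeasurable v)
  · exact (ae_restrict_iff' measurableSet_Icc).2 (ae_of_all _ fun s hs =>
      (P s).le_of_opNorm_le (hB s hs) _)

theorem intervalIntegrable_apply (v : L2Time V) (hP : ContinuousOn P (Icc 0 1)) {s t : ℝ}
    (hs : s ∈ Icc (0 : ℝ) 1) (ht : t ∈ Icc (0 : ℝ) 1) :
    IntervalIntegrable (fun s => P s (v s)) volume s t :=
  intervalIntegrable_of_mem_Icc (integrableOn_apply v hP) hs ht

theorem continuousOn_integral_apply (v : L2Time V) (hP : ContinuousOn P (Icc 0 1)) :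
    ContinuousOn (fun t => ∫ s in (0 : ℝ)..t, P s (v s)) (Icc 0 1) := by
  have := intervalIntegral.continuousOn_primitive_interval (μ := volume) (a := 0) (b := 1)
    (f := fun s => P s (v s))
  rw [uIcc_of_le zero_le_one] at this
  exact this (integrableOn_apply v hP)

theorem norm_integral_apply_le (v : L2Time V) {f : ℝ → ℝ} (hf : ContinuousOn f (Icc 0 1))
    (hPf : ∀ s ∈ Icc (0 : ℝ) 1, ‖P s‖ ≤ f s) {s t : ℝ} (hs : 0 ≤ s) (hst : s ≤ t) (ht : t ≤ 1) :
    ‖∫ r in s..t, P r (v r)‖ ≤ ∫ r in s..t, ‖v r‖ * f r :=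
  intervalIntegral.norm_integral_le_of_norm_le hst
    (ae_of_all _ fun r hr => ((P r).le_of_opNorm_le
      (hPf r ⟨hs.trans hr.1.le, hr.2.trans ht⟩) _).trans_eq (mul_comm _ _))
    (intervalIntegrable_norm_mul v hf ⟨hs, hst.trans ht⟩ ⟨hs.trans hst, ht⟩)

theorem sq_norm_integral_apply_le (v : L2Time V) {f : ℝ → ℝ} (hf : ContinuousOn f (Icc 0 1))
    (hPf : ∀ s ∈ Icc (0 : ℝ) 1, ‖P s‖ ≤ f s) {s t : ℝ} (hs : 0 ≤ s) (hst : s ≤ t) (ht : t ≤ 1) :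
    ‖∫ r in s..t, P r (v r)‖ ^ 2 ≤ ‖v‖ ^ 2 * ∫ r in s..t, f r ^ 2 :=
  (pow_le_pow_left₀ (norm_nonneg _) (norm_integral_apply_le v hf hPf hs hst ht) 2).trans
    (sq_integral_norm_mul_le v hf hs hst ht)

theorem norm_integral_apply_le_mul_sqrt (v : L2Time V) {B : ℝ}
    (hB : ∀ s ∈ Icc (0 : ℝ) 1, ‖P s‖ ≤ B) {s t : ℝ} (hs : 0 ≤ s) (hst : s ≤ t) (ht : t ≤ 1) :
    ‖∫ r in s..t, P r (v r)‖ ≤ B * ‖v‖ * √(t - s) := by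
  have hB0 : 0 ≤ B := (norm_nonneg _).trans (hB s ⟨hs, hst.trans ht⟩)
  calc ‖∫ r in s..t, P r (v r)‖ ≤ ∫ r in s..t, ‖v r‖ * B :=
        norm_integral_apply_le v continuousOn_const hB hs hst ht
    _ = B * ∫ r in s..t, ‖v r‖ := by rw [intervalIntegral.integral_mul_const, mul_comm]
    _ ≤ B * ‖v‖ * √(t - s) := by
        rw [mul_assoc]
        exact mul_le_mul_of_nonneg_left (integral_norm_le v hs hst ht) hB0

theorem integral_apply_congr {f g : ℝ → V} (hfg : f =ᵐ[volume.restrict (Icc (0 : ℝ) 1)] g) {t : ℝ}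
    (ht : t ∈ Icc (0 : ℝ) 1) : ∫ s in (0 : ℝ)..t, P s (f s) = ∫ s in (0 : ℝ)..t, P s (g s) := by
  rw [intervalIntegral.integral_of_le ht.1, intervalIntegral.integral_of_le ht.1]
  refine integral_congr_ae ?_
  filter_upwards [ae_restrict_of_ae_restrict_of_subset
    (fun r hr => ⟨hr.1.le, hr.2.trans ht.2⟩ : Ioc 0 t ⊆ Icc 0 1) hfg] with s hs
  rw [hs]

theorem exists_clm_integral_apply (hP : ContinuousOn P (Icc 0 1)) {t : ℝ}
    (ht : t ∈ Icc (0 : ℝ) 1) :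
    ∃ T : L2Time V →L[ℝ] E, ∀ v, T v = ∫ s in (0 : ℝ)..t, P s (v s) := by
  obtain ⟨B, hB⟩ := isCompact_Icc.exists_bound_of_continuousOn hP
  have h0 : (0 : ℝ) ∈ Icc (0 : ℝ) 1 := left_mem_Icc.2 zero_le_one
  let T : L2Time V →ₗ[ℝ] E :=
    { toFun := fun v => ∫ s in (0 : ℝ)..t, P s (v s)
      map_add' := fun v w => by
        rw [integral_apply_congr (Lp.coeFn_add v w) ht]
        simp only [Pi.add_apply, map_add]
        exact intervalIntegral.integral_add (intervalIntegrable_apply v hP h0 ht)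
          (intervalIntegrable_apply w hP h0 ht)
      map_smul' := fun c v => by
        rw [integral_apply_congr (Lp.coeFn_smul c v) ht]
        simp }
  refine ⟨T.mkContinuous (B * √(t - 0)) fun v => ?_, fun v => rfl⟩
  exact (norm_integral_apply_le_mul_sqrt v hB le_rfl ht.1 ht.2).trans_eq (by ring)

theorem norm_integral_apply_sub_le (v : L2Time V) (hP : ContinuousOn P (Icc 0 1)) {B : ℝ}
    (hB : ∀ s ∈ Icc (0 : ℝ) 1, ‖P s‖ ≤ B) {s t : ℝ} (hs : s ∈ Icc (0 : ℝ) 1)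
    (ht : t ∈ Icc (0 : ℝ) 1) :
    ‖(∫ r in (0 : ℝ)..s, P r (v r)) - ∫ r in (0 : ℝ)..t, P r (v r)‖ ≤ B * ‖v‖ * √|s - t| := by
  wlog hst : t ≤ s generalizing s t
  · rw [norm_sub_rev, abs_sub_comm]
    exact this ht hs (le_of_not_ge hst)
  have h0 : (0 : ℝ) ∈ Icc (0 : ℝ) 1 := left_mem_Icc.2 zero_le_one
  rw [intervalIntegral.integral_interval_sub_left (intervalIntegrable_apply v hP h0 hs)
    (intervalIntegrable_apply v hP h0 ht), abs_of_nonneg (sub_nonneg.2 hst)]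
  exact norm_integral_apply_le_mul_sqrt v hB ht.1 hst hs.2

theorem tendstoUniformlyOn_integral_apply [FiniteDimensional ℝ E] {ι : Type*} {l : Filter ι}
    {u : ι → L2Time V} {v : L2Time V} {M : ℝ} (hM : ∀ i, ‖u i‖ ≤ M) (huv : TendstoWeakly u l v)
    (hP : ContinuousOn P (Icc 0 1)) :
    TendstoUniformlyOn (fun i t => ∫ s in (0 : ℝ)..t, P s (u i s))
      (fun t => ∫ s in (0 : ℝ)..t, P s (v s)) l (Icc 0 1) := by
  obtain ⟨B, hB⟩ := isCompact_Icc.exists_bound_of_continuousOn hP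
  have hB0 : 0 ≤ B := (norm_nonneg _).trans (hB 0 (left_mem_Icc.2 zero_le_one))
  let F : ι → Icc (0 : ℝ) 1 → E := fun i t => ∫ s in (0 : ℝ)..t, P s (u i s)
  have hF : Equicontinuous F := by
    refine Metric.equicontinuous_of_continuity_modulus (fun δ => B * M * √δ) ?_ F fun s t i => ?_
    · simpa using ((Real.continuous_sqrt.const_mul (B * M)).tendsto 0)
    · rw [dist_eq_norm]
      refine (norm_integral_apply_sub_le (u i) hP hB s.2 t.2).trans ?_
      have := hM i
      rw [Subtype.dist_eq, Real.dist_eq]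
      gcongr
  have hpt : Tendsto F l (𝓝 fun t => ∫ s in (0 : ℝ)..t, P s (v s)) := tendsto_pi_nhds.2 fun t => by
    obtain ⟨T, hT⟩ := exists_clm_integral_apply hP t.2
    simpa only [F, ← hT] using huv.tendsto_apply T
  rw [tendstoUniformlyOn_iff_tendstoUniformly_comp_coe]
  exact UniformFun.tendsto_iff_tendstoUniformly.1 ((hF.tendsto_uniformFun_iff_pi l _).2 hpt)

theorem norm_sub_le_of_integral_eq (u v : L2Time V) (hP : ContinuousOn P (Icc 0 1))
    {Q : ℝ → V →L[ℝ] E} (hQ : ContinuousOn Q (Icc 0 1)) {y z : ℝ → E} {x : E}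
    (hyc : ContinuousOn y (Icc 0 1)) (hzc : ContinuousOn z (Icc 0 1))
    (hy : ∀ t ∈ Icc (0 : ℝ) 1, y t = x + ∫ s in (0 : ℝ)..t, P s (v s))
    (hz : ∀ t ∈ Icc (0 : ℝ) 1, z t = x + ∫ s in (0 : ℝ)..t, Q s (u s)) {c δ : ℝ}
    (hPQ : ∀ s ∈ Icc (0 : ℝ) 1, ‖Q s - P s‖ ≤ c * ‖z s - y s‖ + δ)
    (huv : ∀ t ∈ Icc (0 : ℝ) 1,
      ‖(∫ s in (0 : ℝ)..t, P s (u s)) - ∫ s in (0 : ℝ)..t, P s (v s)‖ ≤ δ)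
    {t : ℝ} (ht : t ∈ Icc (0 : ℝ) 1) :
    ‖z t - y t‖ ≤ δ * (1 + ‖u‖) * (2 * Real.exp ((c * ‖u‖) ^ 2)) := by
  have h0 : (0 : ℝ) ∈ Icc (0 : ℝ) 1 := left_mem_Icc.2 zero_le_one
  have hδ : 0 ≤ δ := (norm_nonneg _).trans (huv 0 h0)
  have hfc : ContinuousOn (fun s => ‖z s - y s‖) (Icc 0 1) := (hzc.sub hyc).norm
  have hgronwall := gronwall_add u hfc (fun _ _ => norm_nonneg _) hδ hδ (K := c) fun t ht => by
    have hsplit : z t - y t = ((∫ s in (0 : ℝ)..t, P s (u s)) - ∫ s in (0 : ℝ)..t, P s (v s)) +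
        ∫ s in (0 : ℝ)..t, (Q s - P s) (u s) := by
      simp only [sub_apply]
      rw [hz t ht, hy t ht, intervalIntegral.integral_sub (intervalIntegrable_apply _ hQ h0 ht)
        (intervalIntegrable_apply _ hP h0 ht)]
      abel
    rw [hsplit]
    exact (norm_add_le _ _).trans (add_le_add (huv t ht)
      (norm_integral_apply_le u (by fun_prop) hPQ le_rfl ht.1 ht.2))
  exact (hgronwall t ht).trans_eq (by ring)

theorem tendstoUniformlyOn_of_integral_eq [FiniteDimensional ℝ E] {ι : Type*} {l : Filter ι}
    {u : ι → L2Time V} {v : L2Time V} {M : ℝ} (hM : ∀ i, ‖u i‖ ≤ M) (huv : TendstoWeakly u l v)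
    (hP : ContinuousOn P (Icc 0 1)) {Q : ι → ℝ → V →L[ℝ] E}
    (hQ : ∀ i, ContinuousOn (Q i) (Icc 0 1)) {y : ℝ → E} {z : ι → ℝ → E} {x : E}
    (hyc : ContinuousOn y (Icc 0 1)) (hzc : ∀ i, ContinuousOn (z i) (Icc 0 1))
    (hy : ∀ t ∈ Icc (0 : ℝ) 1, y t = x + ∫ s in (0 : ℝ)..t, P s (v s))
    (hz : ∀ i, ∀ t ∈ Icc (0 : ℝ) 1, z i t = x + ∫ s in (0 : ℝ)..t, Q i s (u i s))
    {c : ℝ} (hc : 0 ≤ c) (hPQ : ∀ δ > 0, ∀ᶠ i in l, ∀ s ∈ Icc (0 : ℝ) 1,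
      ‖Q i s - P s‖ ≤ c * ‖z i s - y s‖ + δ) :
    TendstoUniformlyOn z y l (Icc 0 1) := by
  rw [Metric.tendstoUniformlyOn_iff]
  intro ε hε
  set C := (1 + |M|) * (2 * Real.exp ((c * |M|) ^ 2)) with hC
  have hC0 : 0 < C := by positivity
  have hδ0 : 0 < ε / (2 * C) := by positivity
  filter_upwards [Metric.tendstoUniformlyOn_iff.1 (tendstoUniformlyOn_integral_apply hM huv hP) _
    hδ0, hPQ _ hδ0] with i hi hPQi t ht
  have hiM : ‖u i‖ ≤ |M| := (hM i).trans (le_abs_self M)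
  rw [dist_comm, dist_eq_norm]
  calc ‖z i t - y t‖
      ≤ ε / (2 * C) * (1 + ‖u i‖) * (2 * Real.exp ((c * ‖u i‖) ^ 2)) :=
        norm_sub_le_of_integral_eq (u i) v hP (hQ i) hyc (hzc i) hy (hz i) hPQi (fun t ht => by
          rw [← dist_eq_norm, dist_comm]
          exact (hi t ht).le) ht
    _ ≤ ε / (2 * C) * (1 + |M|) * (2 * Real.exp ((c * |M|) ^ 2)) := by gcongr
    _ = ε / 2 := by
        rw [mul_assoc, ← hC]
        field_simp
    _ < ε := half_lt_self hε

theorem eq_zero_of_integral_eq (v : L2Time V) (hP : ContinuousOn P (Icc 0 1)) {h : ℝ → E}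
    (hh : ContinuousOn h (Icc 0 1)) {x : E} {c : ℝ}
    (hPh : ∀ s ∈ Icc (0 : ℝ) 1, ‖P s‖ ≤ c * ‖h s‖)
    (heq : ∀ t ∈ Icc (0 : ℝ) 1, h t = x + ∫ s in (0 : ℝ)..t, P s (v s)) {t : ℝ}
    (ht : t ∈ Icc (0 : ℝ) 1) (hht : h t = 0) : x = 0 := by
  have h0 : (0 : ℝ) ∈ Icc (0 : ℝ) 1 := left_mem_Icc.2 zero_le_one
  have hsq : ∀ s ∈ Icc 0 t, ‖h s‖ ^ 2 ≤ (c * ‖v‖) ^ 2 * ∫ r in s..t, ‖h r‖ ^ 2 := by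
    intro s hs
    have hs1 : s ∈ Icc (0 : ℝ) 1 := ⟨hs.1, hs.2.trans ht.2⟩
    have hback : h s = - ∫ r in s..t, P r (v r) := by
      rw [← intervalIntegral.integral_interval_sub_left (intervalIntegrable_apply v hP h0 ht)
        (intervalIntegrable_apply v hP h0 hs1), heq s hs1,
        eq_neg_of_add_eq_zero_left ((heq t ht).symm.trans hht)]
      abel
    rw [hback, norm_neg]
    refine (sq_norm_integral_apply_le v (hh.norm.const_mul c) hPh hs.1 hs.2 ht.2).trans_eq ?_
    simp only [mul_pow, intervalIntegral.integral_const_mul]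
    ring
  have hzero := eq_zero_of_le_integral_right ((hh.mono (Icc_subset_Icc_right ht.2)).norm.pow 2)
    (fun _ _ => sq_nonneg _) (sq_nonneg _) hsq (left_mem_Icc.2 ht.1)
  have hh0 : h 0 = 0 := by simpa using hzero
  simpa [hh0] using (heq 0 h0).symm

section Picard

variable {V E : Type*} [NormedAddCommGroup V] [NormedSpace ℝ V] [NormedAddCommGroup E]
  [NormedSpace ℝ E] (v : L2Time V) {G : ℝ → E → V →L[ℝ] E}
  (hG : ∀ y : ℝ → E, ContinuousOn y (Icc 0 1) → ContinuousOn (fun s => G s (y s)) (Icc 0 1))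

/-- The Picard operator of the equation `y' = G(t, y) v_t`, `y_0 = x`, on continuous paths, which
are extended by constants outside `[0,1]` in the integrand. -/
def picard (x : E) (y : C(Icc (0 : ℝ) 1, E)) : C(Icc (0 : ℝ) 1, E) where
  toFun t := x + ∫ s in (0 : ℝ)..t, G s (IccExtend zero_le_one y s) (v s)
  continuous_toFun := (continuousOn_const.add
    (continuousOn_integral_apply v (hG _ y.continuous.Icc_extend'.continuousOn))).domRestrict

theorem picard_apply (x : E) (y : C(Icc (0 : ℝ) 1, E)) (t : Icc (0 : ℝ) 1) :
    picard v hG x y t = x + ∫ s in (0 : ℝ)..t, G s (IccExtend zero_le_one y s) (v s) :=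
  rfl

variable {c : ℝ} (hGc : ∀ s ∈ Icc (0 : ℝ) 1, ∀ z z', ‖G s z - G s z'‖ ≤ c * ‖z - z'‖)

include hGc

theorem sq_norm_picard_sub_le (x : E) (y z : C(Icc (0 : ℝ) 1, E)) (t : Icc (0 : ℝ) 1) :
    ‖picard v hG x y t - picard v hG x z t‖ ^ 2 ≤ (c * ‖v‖) ^ 2 *
      ∫ s in (0 : ℝ)..t, ‖IccExtend zero_le_one y s - IccExtend zero_le_one z s‖ ^ 2 := by
  have h0 : (0 : ℝ) ∈ Icc (0 : ℝ) 1 := left_mem_Icc.2 zero_le_one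
  have hy := y.continuous.Icc_extend' (h := zero_le_one)
  have hz := z.continuous.Icc_extend' (h := zero_le_one)
  rw [picard_apply, picard_apply, add_sub_add_left_eq_sub, ← intervalIntegral.integral_sub
    (intervalIntegrable_apply v (hG _ hy.continuousOn) h0 t.2)
    (intervalIntegrable_apply v (hG _ hz.continuousOn) h0 t.2)]
  refine (sq_norm_integral_apply_le v (P := fun s => G s _ - G s _)
    ((hy.sub hz).norm.const_mul c).continuousOn (fun s hs => hGc s hs _ _) le_rfl
    t.2.1 t.2.2).trans_eq ?_
  simp only [mul_pow, intervalIntegral.integral_const_mul, Pi.sub_apply]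
  ring

theorem sq_norm_iterate_picard_sub_le (x : E) (y z : C(Icc (0 : ℝ) 1, E)) (m : ℕ)
    (t : Icc (0 : ℝ) 1) :
    ‖(picard v hG x)^[m] y t - (picard v hG x)^[m] z t‖ ^ 2 ≤
      ((c * ‖v‖) ^ 2 * t) ^ m / m.factorial * dist y z ^ 2 := by
  induction m generalizing t with
  | zero =>
    simpa [← dist_eq_norm] using
      pow_le_pow_left₀ dist_nonneg (ContinuousMap.dist_apply_le_dist t) 2
  | succ m ih =>
    set yₘ := (picard v hG x)^[m] y
    set zₘ := (picard v hG x)^[m] z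
    have hint : ∫ s in (0 : ℝ)..t,
          ‖IccExtend zero_le_one yₘ s - IccExtend zero_le_one zₘ s‖ ^ 2 ≤
        ∫ s in (0 : ℝ)..t, ((c * ‖v‖) ^ 2) ^ m / m.factorial * dist y z ^ 2 * s ^ m := by
      refine intervalIntegral.integral_mono_on t.2.1 ?_ ?_ fun s hs => ?_
      · exact ((yₘ.continuous.Icc_extend'.sub zₘ.continuous.Icc_extend').norm.pow 2)
          |>.intervalIntegrable _ _
      · exact Continuous.intervalIntegrable (by fun_prop) _ _
      · have hs1 : s ∈ Icc (0 : ℝ) 1 := ⟨hs.1, hs.2.trans t.2.2⟩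
        rw [IccExtend_of_mem _ _ hs1, IccExtend_of_mem _ _ hs1]
        exact (ih ⟨s, hs1⟩).trans_eq (by ring)
    rw [Function.iterate_succ_apply', Function.iterate_succ_apply']
    calc ‖picard v hG x yₘ t - picard v hG x zₘ t‖ ^ 2
        ≤ (c * ‖v‖) ^ 2 *
            ∫ s in (0 : ℝ)..t, ‖IccExtend zero_le_one yₘ s - IccExtend zero_le_one zₘ s‖ ^ 2 :=
          sq_norm_picard_sub_le v hG hGc x yₘ zₘ t
      _ ≤ (c * ‖v‖) ^ 2 *
            ∫ s in (0 : ℝ)..t, ((c * ‖v‖) ^ 2) ^ m / m.factorial * dist y z ^ 2 * s ^ m :=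
          mul_le_mul_of_nonneg_left hint (sq_nonneg _)
      _ = ((c * ‖v‖) ^ 2 * t) ^ (m + 1) / (m + 1).factorial * dist y z ^ 2 := by
          rw [intervalIntegral.integral_const_mul, integral_pow, Nat.factorial_succ,
            zero_pow m.succ_ne_zero, sub_zero, mul_pow _ (t : ℝ), pow_succ ((c * ‖v‖) ^ 2) m]
          push_cast
          field_simp

theorem exists_contractingWith_iterate_picard (x : E) :
    ∃ m : ℕ, ContractingWith (1 / 2) (picard v hG x)^[m] := by
  obtain ⟨m, hm⟩ := ((FloorSemiring.tendsto_pow_div_factorial_atTop ((c * ‖v‖) ^ 2)).eventually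
    (gt_mem_nhds (by norm_num : (0 : ℝ) < 1 / 4))).exists
  refine ⟨m, by norm_num, LipschitzWith.of_dist_le_mul fun y z =>
    (ContinuousMap.dist_le (by positivity)).2 fun t => ?_⟩
  have hcoeff : ((c * ‖v‖) ^ 2 * t) ^ m / m.factorial ≤ 1 / 4 := by
    refine le_trans ?_ hm.le
    gcongr
    · exact mul_nonneg (sq_nonneg _) t.2.1
    · exact mul_le_of_le_one_right (sq_nonneg _) t.2.2
  rw [dist_eq_norm]
  refine (le_abs_self _).trans (abs_le_of_sq_le_sq ?_ (by positivity))
  calc _ ≤ ((c * ‖v‖) ^ 2 * t) ^ m / m.factorial * dist y z ^ 2 :=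
        sq_norm_iterate_picard_sub_le v hG hGc x y z m t
    _ ≤ 1 / 4 * dist y z ^ 2 := mul_le_mul_of_nonneg_right hcoeff (sq_nonneg _)
    _ = (((1 / 2 : NNReal) : ℝ) * dist y z) ^ 2 := by
        rw [mul_pow]
        norm_num

include hG

theorem exists_integral_eq [CompleteSpace E] (x : E) :
    ∃ y : ℝ → E, ContinuousOn y (Icc 0 1) ∧
      ∀ t ∈ Icc (0 : ℝ) 1, y t = x + ∫ s in (0 : ℝ)..t, G s (y s) (v s) := by
  obtain ⟨m, hm⟩ := exists_contractingWith_iterate_picard v hG hGc x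
  have hfix : picard v hG x (hm.fixedPoint _) = hm.fixedPoint _ :=
    hm.isFixedPt_fixedPoint_iterate
  refine ⟨IccExtend zero_le_one (hm.fixedPoint _),
    (hm.fixedPoint _).continuous.Icc_extend'.continuousOn, fun t ht => ?_⟩
  rw [IccExtend_of_mem _ _ ht, ← picard_apply v hG x _ ⟨t, ht⟩, hfix]

end Picard

end L2Time

/-! ### Flows -/

/-- The vector fields of `V` are differentiable, with derivatives bounded and Lipschitz with
constant `c * ‖u‖`: what embedding in `C₀²` provides for flows and their differentials. -/
structure EmbedsC11 {n : ℕ} (V : Type*) [NormedAddCommGroup V] [InnerProductSpace ℝ V]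
    [RKHS ℝ V (Eucl n) (Eucl n)] (c : ℝ) : Prop where
  nonneg : 0 ≤ c
  differentiable : ∀ u : V, Differentiable ℝ (u : Eucl n → Eucl n)
  norm_fderiv_le : ∀ (u : V) (x : Eucl n), ‖fderiv ℝ u x‖ ≤ c * ‖u‖
  norm_fderiv_sub_le : ∀ (u : V) (x y : Eucl n),
    ‖fderiv ℝ u x - fderiv ℝ u y‖ ≤ c * ‖u‖ * ‖x - y‖

section EvalCLM

variable {V X E : Type*} [NormedAddCommGroup V] [InnerProductSpace ℝ V]
  [NormedAddCommGroup E] [InnerProductSpace ℝ E] [RKHS ℝ V X E]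

variable (V) in
/-- Evaluation at a point, as a continuous linear map on a space of functions. -/
def evalCLM (x : X) : V →L[ℝ] E :=
  (ContinuousLinearMap.proj (R := ℝ) (φ := fun _ : X => E) x).comp (RKHS.coeCLM ℝ)

@[simp]
theorem evalCLM_apply (x : X) (u : V) : evalCLM V x u = u x :=
  rfl

end EvalCLM

section Flow

variable {n : ℕ} {V : Type*} [NormedAddCommGroup V] [InnerProductSpace ℝ V]
  [RKHS ℝ V (Eucl n) (Eucl n)]

theorem EmbedsC20.exists_embedsC11 (hV : EmbedsC20 V) : ∃ c, EmbedsC11 V c := by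
  obtain ⟨hC2, c, hc⟩ := hV
  have hle (u : V) {j : ℕ} (hj : j ≤ 2) (x : Eucl n) :
      ‖iteratedFDeriv ℝ j u x‖ ≤ max c 0 * ‖u‖ :=
    (hc u j hj x).trans (mul_le_mul_of_nonneg_right (le_max_left _ _) (norm_nonneg _))
  refine ⟨max c 0, le_max_right _ _, fun u => (hC2 u).1.differentiable two_ne_zero,
    fun u x => ?_, fun u x y => ?_⟩
  · rw [← norm_iteratedFDeriv_one]
    exact hle u one_le_two x
  · have hd : Differentiable ℝ (fderiv ℝ u) :=
      ((hC2 u).1.fderiv_right (m := 1) le_rfl).differentiable one_ne_zero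
    refine convex_univ.norm_image_sub_le_of_norm_fderiv_le (𝕜 := ℝ) (fun z _ => hd z)
      (fun z _ => ?_) (mem_univ y) (mem_univ x)
    rw [← norm_iteratedFDeriv_one, norm_iteratedFDeriv_fderiv]
    exact hle u le_rfl z

namespace EmbedsC11

variable {c : ℝ} (hV : EmbedsC11 V c)

include hV in
theorem norm_sub_le (u : V) (x y : Eucl n) : ‖u x - u y‖ ≤ c * ‖u‖ * ‖x - y‖ :=
  convex_univ.norm_image_sub_le_of_norm_fderiv_le (𝕜 := ℝ) (fun z _ => hV.differentiable u z)
    (fun z _ => hV.norm_fderiv_le u z) (mem_univ y) (mem_univ x)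

include hV in
theorem norm_sub_sub_fderiv_le (u : V) (x y : Eucl n) :
    ‖u y - u x - fderiv ℝ u x (y - x)‖ ≤ c * ‖u‖ * ‖y - x‖ ^ 2 := by
  have h := (convex_segment x y).norm_image_sub_le_of_norm_fderiv_le' (𝕜 := ℝ)
    (f := u) (φ := fderiv ℝ u x) (C := c * ‖u‖ * ‖y - x‖) (fun z _ => hV.differentiable u z)
    (fun z hz => (hV.norm_fderiv_sub_le u z x).trans (mul_le_mul_of_nonneg_left
      (norm_sub_le_of_mem_segment hz) (mul_nonneg hV.nonneg (norm_nonneg _))))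
    (left_mem_segment ℝ x y) (right_mem_segment ℝ x y)
  exact h.trans_eq (by ring)

include hV in
theorem norm_evalCLM_sub_le (x y : Eucl n) : ‖evalCLM V x - evalCLM V y‖ ≤ c * ‖x - y‖ :=
  ContinuousLinearMap.opNorm_le_bound _ (mul_nonneg hV.nonneg (norm_nonneg _)) fun u =>
    (hV.norm_sub_le u x y).trans_eq (by ring)

include hV in
theorem continuous_evalCLM : Continuous (evalCLM V : Eucl n → V →L[ℝ] Eucl n) :=
  (LipschitzWith.of_dist_le' (K := c) fun x y => by
    rw [dist_eq_norm, dist_eq_norm]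
    exact hV.norm_evalCLM_sub_le x y).continuous

/-- The differential at a point, as a continuous linear map on a space of vector fields. -/
def fderivCLM (x : Eucl n) : V →L[ℝ] Eucl n →L[ℝ] Eucl n :=
  LinearMap.mkContinuous
    { toFun := fun u => fderiv ℝ u x
      map_add' := fun u w => by
        rw [RKHS.coe_add]
        exact fderiv_add (hV.differentiable u x) (hV.differentiable w x)
      map_smul' := fun r u => by
        rw [RKHS.coe_smul]
        exact fderiv_const_smul (hV.differentiable u x) r } c fun u => hV.norm_fderiv_le u x

theorem norm_fderivCLM_sub_le (x y : Eucl n) :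
    ‖hV.fderivCLM x - hV.fderivCLM y‖ ≤ c * ‖x - y‖ :=
  ContinuousLinearMap.opNorm_le_bound _ (mul_nonneg hV.nonneg (norm_nonneg _)) fun u =>
    (hV.norm_fderiv_sub_le u x y).trans_eq (by ring)

theorem continuous_fderivCLM : Continuous hV.fderivCLM := by
  have h : LipschitzWith c.toNNReal hV.fderivCLM := LipschitzWith.of_dist_le' fun x y => by
    rw [dist_eq_norm, dist_eq_norm]
    exact hV.norm_fderivCLM_sub_le x y
  exact h.continuous

/-- The right-hand side `u ↦ d_x u ∘ A` of the equation of the differential of a flow. -/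
def linearized (x : Eucl n) (A : Eucl n →L[ℝ] Eucl n) : V →L[ℝ] Eucl n →L[ℝ] Eucl n :=
  ((ContinuousLinearMap.compL ℝ (Eucl n) (Eucl n) (Eucl n)).flip A).comp (hV.fderivCLM x)

@[simp]
theorem linearized_apply (x : Eucl n) (A : Eucl n →L[ℝ] Eucl n) (u : V) :
    hV.linearized x A u = (fderiv ℝ u x).comp A :=
  rfl

theorem norm_linearized_sub_le (x : Eucl n) (A B : Eucl n →L[ℝ] Eucl n) :
    ‖hV.linearized x A - hV.linearized x B‖ ≤ c * ‖A - B‖ := by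
  refine ContinuousLinearMap.opNorm_le_bound _ (mul_nonneg hV.nonneg (norm_nonneg _)) fun u => ?_
  rw [sub_apply, linearized_apply, linearized_apply, ← ContinuousLinearMap.comp_sub]
  exact (ContinuousLinearMap.opNorm_comp_le _ _).trans
    ((mul_le_mul_of_nonneg_right (hV.norm_fderiv_le u x) (norm_nonneg _)).trans_eq (by ring))

theorem norm_linearized_sub_linearized_le (x y : Eucl n) (A : Eucl n →L[ℝ] Eucl n) :
    ‖hV.linearized x A - hV.linearized y A‖ ≤ c * ‖x - y‖ * ‖A‖ := by
  refine ContinuousLinearMap.opNorm_le_bound _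
    (mul_nonneg (mul_nonneg hV.nonneg (norm_nonneg _)) (norm_nonneg _)) fun u => ?_
  rw [sub_apply, linearized_apply, linearized_apply, ← ContinuousLinearMap.sub_comp]
  exact (ContinuousLinearMap.opNorm_comp_le _ _).trans
    ((mul_le_mul_of_nonneg_right (hV.norm_fderiv_sub_le u x y) (norm_nonneg _)).trans_eq (by ring))

theorem continuousOn_linearized {y : ℝ → Eucl n} {A : ℝ → Eucl n →L[ℝ] Eucl n} {s : Set ℝ}
    (hy : ContinuousOn y s) (hA : ContinuousOn A s) :
    ContinuousOn (fun t => hV.linearized (y t) (A t)) s :=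
  ((ContinuousLinearMap.compL ℝ (Eucl n) (Eucl n) (Eucl n)).flip.continuous.comp_continuousOn
    hA).clm_comp (hV.continuous_fderivCLM.comp_continuousOn hy)

include hV

theorem exists_isFlow (v : L2Time V) : ∃ φ, IsFlow (n := n) v φ := by
  choose y hy using L2Time.exists_integral_eq v (G := fun _ z => evalCLM V z)
    (fun y hy => hV.continuous_evalCLM.comp_continuousOn hy)
    (fun _ _ z z' => hV.norm_evalCLM_sub_le z z')
  exact ⟨fun t x => y x t, hy⟩

theorem isFlow_flowMap (v : L2Time V) : IsFlow v (flowMap v) := by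
  rw [flowMap, dif_pos (hV.exists_isFlow v)]
  exact (hV.exists_isFlow v).choose_spec

theorem continuousOn_flowMap (v : L2Time V) (x : Eucl n) :
    ContinuousOn (fun t => flowMap v t x) (Icc 0 1) :=
  (hV.isFlow_flowMap v x).1

theorem flowMap_eq (v : L2Time V) (x : Eucl n) {t : ℝ} (ht : t ∈ Icc (0 : ℝ) 1) :
    flowMap v t x = x + ∫ s in (0 : ℝ)..t, evalCLM V (flowMap v s x) (v s) :=
  (hV.isFlow_flowMap v x).2 t ht

theorem continuousOn_evalCLM_flowMap (v : L2Time V) (x : Eucl n) :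
    ContinuousOn (fun t => evalCLM V (flowMap v t x)) (Icc 0 1) :=
  hV.continuous_evalCLM.comp_continuousOn (hV.continuousOn_flowMap v x)

theorem norm_flowMap_sub_le (v : L2Time V) (x y : Eucl n) {t : ℝ} (ht : t ∈ Icc (0 : ℝ) 1) :
    ‖flowMap v t x - flowMap v t y‖ ≤ ‖x - y‖ * (2 * Real.exp ((c * ‖v‖) ^ 2)) := by
  have h0 : (0 : ℝ) ∈ Icc (0 : ℝ) 1 := left_mem_Icc.2 zero_le_one
  have hcont : ContinuousOn (fun t => ‖flowMap v t x - flowMap v t y‖) (Icc 0 1) :=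
    ((hV.continuousOn_flowMap v x).sub (hV.continuousOn_flowMap v y)).norm
  refine L2Time.gronwall v hcont (fun _ _ => norm_nonneg _) (norm_nonneg _) (fun t ht => ?_) t ht
  have hdiff : flowMap v t x - flowMap v t y = (x - y) +
      ∫ s in (0 : ℝ)..t, (evalCLM V (flowMap v s x) - evalCLM V (flowMap v s y)) (v s) := by
    simp only [sub_apply]
    rw [intervalIntegral.integral_sub
      (L2Time.intervalIntegrable_apply v (hV.continuousOn_evalCLM_flowMap v x) h0 ht)
      (L2Time.intervalIntegrable_apply v (hV.continuousOn_evalCLM_flowMap v y) h0 ht),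
      hV.flowMap_eq v x ht, hV.flowMap_eq v y ht]
    abel
  rw [hdiff]
  refine (norm_add_le _ _).trans (add_le_add_right ?_ _)
  refine (L2Time.norm_integral_apply_le v (hcont.const_mul c)
    (fun s _ => hV.norm_evalCLM_sub_le _ _) le_rfl ht.1 ht.2).trans_eq ?_
  rw [← intervalIntegral.integral_const_mul]
  exact intervalIntegral.integral_congr fun s _ => by ring

end EmbedsC11

end Flow

namespace EmbedsC11

variable {n : ℕ} {V : Type*} [NormedAddCommGroup V] [InnerProductSpace ℝ V]
  [RKHS ℝ V (Eucl n) (Eucl n)] {c : ℝ} (hV : EmbedsC11 V c) (v : L2Time V) (x : Eucl n)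

section Differential

/-- The remainder of the first order expansion at `x` of the flow of `v` in the direction `h`,
where `A t` is the candidate for the differential at time `t`. -/
def flowRemainder (v : L2Time V) (x h : Eucl n) (A : ℝ → Eucl n →L[ℝ] Eucl n) (t : ℝ) : Eucl n :=
  flowMap v t (x + h) - flowMap v t x - A t h

theorem exists_eq_integral_linearized :
    ∃ A : ℝ → Eucl n →L[ℝ] Eucl n, ContinuousOn A (Icc 0 1) ∧
      ∀ t ∈ Icc (0 : ℝ) 1, A t = ContinuousLinearMap.id ℝ (Eucl n) +
        ∫ s in (0 : ℝ)..t, hV.linearized (flowMap v s x) (A s) (v s) :=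
  L2Time.exists_integral_eq v (G := fun s A => hV.linearized (flowMap v s x) A)
    (fun _ hA => hV.continuousOn_linearized (hV.continuousOn_flowMap v x) hA)
    (fun _ _ A B => hV.norm_linearized_sub_le _ A B) (ContinuousLinearMap.id ℝ (Eucl n))

variable {v x} (h : Eucl n) {A : ℝ → Eucl n →L[ℝ] Eucl n} (hAc : ContinuousOn A (Icc 0 1))

include hV hAc in
theorem continuousOn_flowRemainder : ContinuousOn (flowRemainder v x h A) (Icc 0 1) :=
  ((hV.continuousOn_flowMap v _).sub (hV.continuousOn_flowMap v _)).sub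
    (hAc.clm_apply continuousOn_const)

/-- The integrand of the equation satisfied by `flowRemainder`. -/
def flowRemainderDeriv (v : L2Time V) (x h : Eucl n) (A : Eucl n →L[ℝ] Eucl n) (t : ℝ) :
    V →L[ℝ] Eucl n :=
  evalCLM V (flowMap v t (x + h)) - evalCLM V (flowMap v t x) -
    (ContinuousLinearMap.apply ℝ (Eucl n) h).comp (hV.linearized (flowMap v t x) A)

variable (hA : ∀ t ∈ Icc (0 : ℝ) 1, A t = ContinuousLinearMap.id ℝ (Eucl n) +
  ∫ s in (0 : ℝ)..t, hV.linearized (flowMap v s x) (A s) (v s))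

include hAc hA in
theorem flowRemainder_eq_integral {t : ℝ} (ht : t ∈ Icc (0 : ℝ) 1) :
    flowRemainder v x h A t =
      ∫ s in (0 : ℝ)..t, hV.flowRemainderDeriv v x h (A s) s (v s) := by
  have h0 : (0 : ℝ) ∈ Icc (0 : ℝ) 1 := left_mem_Icc.2 zero_le_one
  have hy := L2Time.intervalIntegrable_apply v (hV.continuousOn_evalCLM_flowMap v (x + h)) h0 ht
  have hx := L2Time.intervalIntegrable_apply v (hV.continuousOn_evalCLM_flowMap v x) h0 ht
  have hL := L2Time.intervalIntegrable_apply v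
    (hV.continuousOn_linearized (hV.continuousOn_flowMap v x) hAc) h0 ht
  have hLh : IntervalIntegrable (fun s => hV.linearized (flowMap v s x) (A s) (v s) h)
      volume 0 t :=
    ⟨(ContinuousLinearMap.apply ℝ (Eucl n) h).integrable_comp hL.1,
      (ContinuousLinearMap.apply ℝ (Eucl n) h).integrable_comp hL.2⟩
  simp only [flowRemainder, flowRemainderDeriv, sub_apply, ContinuousLinearMap.comp_apply,
    ContinuousLinearMap.apply_apply]
  rw [intervalIntegral.integral_sub (hy.sub hx) hLh, intervalIntegral.integral_sub hy hx,
    ← ContinuousLinearMap.intervalIntegral_apply hL, hV.flowMap_eq v _ ht, hV.flowMap_eq v x ht,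
    hA t ht]
  simp only [add_apply, ContinuousLinearMap.id_apply]
  abel

theorem norm_flowRemainderDeriv_le {t : ℝ} (ht : t ∈ Icc (0 : ℝ) 1) :
    ‖hV.flowRemainderDeriv v x h (A t) t‖ ≤ c * ‖flowRemainder v x h A t‖ +
      c * (‖h‖ * (2 * Real.exp ((c * ‖v‖) ^ 2))) ^ 2 := by
  have hc := hV.nonneg
  refine ContinuousLinearMap.opNorm_le_bound _ (by positivity) fun u => ?_
  set y := flowMap v t x
  set z := flowMap v t (x + h)
  have hsplit : hV.flowRemainderDeriv v x h (A t) t u =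
      (u z - u y - fderiv ℝ u y (z - y)) + fderiv ℝ u y (flowRemainder v x h A t) := by
    simp only [flowRemainderDeriv, flowRemainder, sub_apply, evalCLM_apply,
      ContinuousLinearMap.comp_apply, ContinuousLinearMap.apply_apply, linearized_apply, map_sub,
      y, z]
    abel
  have hzy : ‖z - y‖ ≤ ‖h‖ * (2 * Real.exp ((c * ‖v‖) ^ 2)) := by
    simpa using hV.norm_flowMap_sub_le v (x + h) x ht
  rw [hsplit]
  calc _ ≤ c * ‖u‖ * ‖z - y‖ ^ 2 + c * ‖u‖ * ‖flowRemainder v x h A t‖ :=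
        (norm_add_le _ _).trans (add_le_add (hV.norm_sub_sub_fderiv_le u y z)
          ((fderiv ℝ u y).le_of_opNorm_le (hV.norm_fderiv_le u y) _))
    _ ≤ c * ‖u‖ * (‖h‖ * (2 * Real.exp ((c * ‖v‖) ^ 2))) ^ 2 +
          c * ‖u‖ * ‖flowRemainder v x h A t‖ := by gcongr
    _ = _ := by ring

include hAc hA in
theorem norm_flowRemainder_le {t : ℝ} (ht : t ∈ Icc (0 : ℝ) 1) :
    ‖flowRemainder v x h A t‖ ≤
      c * ‖v‖ * (2 * Real.exp ((c * ‖v‖) ^ 2)) ^ 3 * ‖h‖ ^ 2 := by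
  have hc := hV.nonneg
  have hR : ContinuousOn (fun s => ‖flowRemainder v x h A s‖) (Icc 0 1) :=
    (hV.continuousOn_flowRemainder h hAc).norm
  refine (L2Time.gronwall_add v hR (fun _ _ => norm_nonneg _) le_rfl
    (δ := c * (‖h‖ * (2 * Real.exp ((c * ‖v‖) ^ 2))) ^ 2) (K := c) (by positivity)
    (fun s hs => ?_) t ht).trans_eq (by ring)
  rw [hV.flowRemainder_eq_integral h hAc hA hs, zero_add]
  exact L2Time.norm_integral_apply_le v (by fun_prop)
    (fun r hr => hV.norm_flowRemainderDeriv_le h hr) le_rfl hs.1 hs.2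

include hV hAc hA in
theorem hasFDerivAt_flowMap {t : ℝ} (ht : t ∈ Icc (0 : ℝ) 1) :
    HasFDerivAt (flowMap v t) (A t) x := by
  have hO : (fun h => flowRemainder v x h A t) =O[𝓝 0] fun h => ‖h‖ ^ 2 :=
    Asymptotics.IsBigO.of_bound _ (Eventually.of_forall fun h =>
      (hV.norm_flowRemainder_le h hAc hA ht).trans_eq (by rw [norm_pow, norm_norm]))
  exact hasFDerivAt_iff_isLittleO_nhds_zero.2
    (hO.trans_isLittleO (Asymptotics.isLittleO_norm_pow_id one_lt_two))

end Differential

include hV in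
theorem continuousOn_fderiv_flowMap :
    ContinuousOn (fun t => fderiv ℝ (flowMap v t) x) (Icc 0 1) := by
  obtain ⟨A, hAc, hA⟩ := hV.exists_eq_integral_linearized v x
  exact hAc.congr fun t ht => (hV.hasFDerivAt_flowMap hAc hA ht).fderiv

theorem fderiv_flowMap_eq {t : ℝ} (ht : t ∈ Icc (0 : ℝ) 1) :
    fderiv ℝ (flowMap v t) x = ContinuousLinearMap.id ℝ (Eucl n) +
      ∫ s in (0 : ℝ)..t, hV.linearized (flowMap v s x) (fderiv ℝ (flowMap v s) x) (v s) := by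
  obtain ⟨A, hAc, hA⟩ := hV.exists_eq_integral_linearized v x
  rw [(hV.hasFDerivAt_flowMap hAc hA ht).fderiv, hA t ht]
  congr 1
  refine intervalIntegral.integral_congr fun s hs => ?_
  rw [uIcc_of_le ht.1] at hs
  simp only [(hV.hasFDerivAt_flowMap hAc hA ⟨hs.1, hs.2.trans ht.2⟩).fderiv]

theorem continuousOn_linearized_flowMap :
    ContinuousOn (fun t => hV.linearized (flowMap v t x) (fderiv ℝ (flowMap v t) x)) (Icc 0 1) :=
  hV.continuousOn_linearized (hV.continuousOn_flowMap v x) (hV.continuousOn_fderiv_flowMap v x)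

theorem fderiv_flowMap_apply_eq (h : Eucl n) {t : ℝ} (ht : t ∈ Icc (0 : ℝ) 1) :
    fderiv ℝ (flowMap v t) x h = h + ∫ s in (0 : ℝ)..t, (ContinuousLinearMap.apply ℝ (Eucl n)
      (fderiv ℝ (flowMap v s) x h)).comp (hV.fderivCLM (flowMap v s x)) (v s) := by
  have hL := L2Time.intervalIntegrable_apply v (hV.continuousOn_linearized_flowMap v x)
    (left_mem_Icc.2 zero_le_one) ht
  rw [hV.fderiv_flowMap_eq v x ht, add_apply, ContinuousLinearMap.id_apply,
    ContinuousLinearMap.intervalIntegral_apply hL]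
  rfl

include hV in
theorem injective_fderiv_flowMap {t : ℝ} (ht : t ∈ Icc (0 : ℝ) 1) :
    Function.Injective (fderiv ℝ (flowMap v t) x) := by
  refine (injective_iff_map_eq_zero _).2 fun h hh => ?_
  have hAh : ContinuousOn (fun s => fderiv ℝ (flowMap v s) x h) (Icc 0 1) :=
    (hV.continuousOn_fderiv_flowMap v x).clm_apply continuousOn_const
  refine L2Time.eq_zero_of_integral_eq v
    (((ContinuousLinearMap.apply ℝ (Eucl n)).continuous.comp_continuousOn hAh).clm_comp
      (hV.continuous_fderivCLM.comp_continuousOn (hV.continuousOn_flowMap v x)))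
    hAh (c := c) (fun s _ => ?_) (fun s hs => hV.fderiv_flowMap_apply_eq v x h hs) ht hh
  refine ContinuousLinearMap.opNorm_le_bound _ (mul_nonneg hV.nonneg (norm_nonneg _)) fun u => ?_
  exact ((fderiv ℝ u _).le_of_opNorm_le (hV.norm_fderiv_le u _) _).trans_eq (by ring)

section WeakConvergence

variable {ι : Type*} {l : Filter ι} {u : ι → L2Time V} {v} {M : ℝ} (hM : ∀ i, ‖u i‖ ≤ M)
  (huv : TendstoWeakly u l v)

include hV hM huv

theorem tendstoUniformlyOn_flowMap :
    TendstoUniformlyOn (fun i t => flowMap (u i) t x) (fun t => flowMap v t x) l (Icc 0 1) :=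
  L2Time.tendstoUniformlyOn_of_integral_eq hM huv (hV.continuousOn_evalCLM_flowMap v x)
    (fun i => hV.continuousOn_evalCLM_flowMap (u i) x) (hV.continuousOn_flowMap v x)
    (fun i => hV.continuousOn_flowMap (u i) x) (fun _ ht => hV.flowMap_eq v x ht)
    (fun i _ ht => hV.flowMap_eq (u i) x ht) hV.nonneg fun _ hδ => Eventually.of_forall
      fun _ _ _ => (hV.norm_evalCLM_sub_le _ _).trans (le_add_of_nonneg_right hδ.le)

theorem eventually_norm_linearized_sub_le {δ : ℝ} (hδ : 0 < δ) :
    ∀ᶠ i in l, ∀ s ∈ Icc (0 : ℝ) 1,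
      ‖hV.linearized (flowMap (u i) s x) (fderiv ℝ (flowMap (u i) s) x) -
        hV.linearized (flowMap v s x) (fderiv ℝ (flowMap v s) x)‖ ≤
      c * ‖fderiv ℝ (flowMap (u i) s) x - fderiv ℝ (flowMap v s) x‖ + δ := by
  obtain ⟨B, hB⟩ := isCompact_Icc.exists_bound_of_continuousOn (hV.continuousOn_fderiv_flowMap v x)
  have hB0 : 0 ≤ B := (norm_nonneg _).trans (hB 0 (left_mem_Icc.2 zero_le_one))
  have hc := hV.nonneg
  filter_upwards [Metric.tendstoUniformlyOn_iff.1 (hV.tendstoUniformlyOn_flowMap x hM huv)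
    (δ / ((c + 1) * (B + 1))) (by positivity)] with i hi s hs
  have hφ := hi s hs
  rw [dist_comm, dist_eq_norm, lt_div_iff₀ (by positivity)] at hφ
  refine (norm_sub_le_norm_sub_add_norm_sub _
    (hV.linearized (flowMap (u i) s x) (fderiv ℝ (flowMap v s) x)) _).trans
    (add_le_add (hV.norm_linearized_sub_le _ _ _)
      ((hV.norm_linearized_sub_linearized_le _ _ _).trans (le_trans ?_ hφ.le)))
  calc _ ≤ (c + 1) * ‖flowMap (u i) s x - flowMap v s x‖ * (B + 1) := by
        gcongr
        · exact le_add_of_nonneg_right zero_le_one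
        · exact (hB s hs).trans (le_add_of_nonneg_right zero_le_one)
    _ = _ := by ring

theorem tendstoUniformlyOn_fderiv_flowMap :
    TendstoUniformlyOn (fun i t => fderiv ℝ (flowMap (u i) t) x)
      (fun t => fderiv ℝ (flowMap v t) x) l (Icc 0 1) :=
  L2Time.tendstoUniformlyOn_of_integral_eq hM huv (hV.continuousOn_linearized_flowMap v x)
    (fun i => hV.continuousOn_linearized_flowMap (u i) x) (hV.continuousOn_fderiv_flowMap v x)
    (fun i => hV.continuousOn_fderiv_flowMap (u i) x) (fun _ ht => hV.fderiv_flowMap_eq v x ht)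
    (fun i _ ht => hV.fderiv_flowMap_eq (u i) x ht) hV.nonneg fun _ hδ =>
      hV.eventually_norm_linearized_sub_le x hM huv hδ

end WeakConvergence

end EmbedsC11

/-! ### Oriented subspaces -/

namespace OGrass

variable {n d : ℕ}

theorem span_surjective : Function.Surjective (span : Frame n d → OGrass n d) :=
  Quotient.mk_surjective

theorem span_eq_span_iff {u w : Frame n d} : span u = span w ↔
    ∃ R : Matrix (Fin d) (Fin d) ℝ, 0 < R.det ∧ ∀ j, w.1 j = ∑ i, R i j • u.1 i :=
  Quotient.eq (r := frameSetoid n d)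

theorem linearIndependent_sum_smul (u : Frame n d) {R : Matrix (Fin d) (Fin d) ℝ}
    (hR : R.det ≠ 0) : LinearIndependent ℝ fun j => ∑ i, R i j • u.1 i := by
  refine Matrix.linearIndependent_of_det_gram_ne_zero ?_
  rw [gram_comb u.1 _ R fun _ => rfl, Matrix.det_mul, Matrix.det_mul, Matrix.det_transpose]
  exact mul_ne_zero (mul_ne_zero hR (Matrix.det_gram_ne_zero_iff_linearIndependent.2 u.2)) hR

theorem continuous_apply_frame (i : Fin d) : Continuous fun u : Frame n d => u.1 i :=
  (continuous_apply i).comp continuous_subtype_val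

theorem isOpenQuotientMap_span : IsOpenQuotientMap (span : Frame n d → OGrass n d) where
  surjective := span_surjective
  continuous := continuous_quot_mk
  isOpenMap O hO := by
    refine isQuotientMap_quot_mk.isOpen_preimage.1 (isOpen_iff_mem_nhds.2 ?_)
    rintro w ⟨u, hu, huw⟩
    obtain ⟨R, hR, hwu⟩ := span_eq_span_iff.1 huw.symm
    let T : Frame n d → Frame n d := fun z => ⟨_, linearIndependent_sum_smul z hR.ne'⟩
    have hT : Continuous T := Continuous.subtype_mk (continuous_pi fun j =>
      continuous_finsetSum _ fun i _ => (continuous_apply_frame i).const_smul (R i j)) _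
    have hTw : T w = u := Subtype.ext (funext fun j => (hwu j).symm)
    filter_upwards [(hO.preimage hT).mem_nhds (show T w ∈ O from hTw ▸ hu)] with z hz
    exact ⟨T z, hz, (span_eq_span_iff.2 ⟨R, hR, fun _ => rfl⟩).symm⟩

theorem det_gram_pos (u : Frame n d) : 0 < (Matrix.gram ℝ u.1).det :=
  (Matrix.posDef_gram_of_linearIndependent u.2).det_pos

theorem det_inner_sum_smul (u w : Fin d → Eucl n) {R : Matrix (Fin d) (Fin d) ℝ}
    (h : ∀ j, w j = ∑ i, R i j • u i) :
    (Matrix.of fun i j => inner ℝ (u i) (w j)).det = (Matrix.gram ℝ u).det * R.det := by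
  rw [← Matrix.det_mul]
  congr 1
  ext i j
  simp [Matrix.mul_apply, h, inner_sum, inner_smul_right, mul_comm]

theorem span_eq_span_iff_mem_span {u w : Frame n d} : span u = span w ↔
    (∀ j, w.1 j ∈ Submodule.span ℝ (range u.1)) ∧
      0 ≤ (Matrix.of fun i j => inner ℝ (u.1 i) (w.1 j)).det := by
  rw [span_eq_span_iff]
  constructor
  · rintro ⟨R, hR, hw⟩
    refine ⟨fun j => ?_, ?_⟩
    · rw [hw]
      exact Submodule.sum_smul_mem _ _ fun i _ => Submodule.subset_span (mem_range_self i)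
    · rw [det_inner_sum_smul u.1 w.1 hw]
      exact (mul_pos (det_gram_pos u) hR).le
  · rintro ⟨h, hpos⟩
    simp only [Submodule.mem_span_range_iff_exists_fun] at h
    choose S hS using h
    have hw : ∀ j, w.1 j = ∑ i, (Matrix.of S).transpose i j • u.1 i := fun j => (hS j).symm
    rw [det_inner_sum_smul u.1 w.1 hw] at hpos
    refine ⟨_, lt_of_le_of_ne (nonneg_of_mul_nonneg_right hpos (det_gram_pos u)) fun h0 => ?_, hw⟩
    have := det_gram_pos w
    rw [gram_comb u.1 w.1 _ hw, Matrix.det_mul, ← h0, mul_zero] at this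
    exact this.false

instance : T1Space (OGrass n d) := by
  refine ⟨fun U => ?_⟩
  obtain ⟨u, rfl⟩ := span_surjective U
  have hfiber : (span : Frame n d → OGrass n d) ⁻¹' {span u} =
      (⋂ j, {w | w.1 j ∈ Submodule.span ℝ (range u.1)}) ∩
        {w | 0 ≤ (Matrix.of fun i j => inner ℝ (u.1 i) (w.1 j)).det} := by
    ext w
    rw [mem_preimage, mem_singleton_iff, eq_comm, span_eq_span_iff_mem_span]
    simp
  rw [← isOpenQuotientMap_span.isQuotientMap.isClosed_preimage, hfiber]
  refine (isClosed_iInter fun j =>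
    (Submodule.closed_of_finiteDimensional _).preimage (continuous_apply_frame j)).inter ?_
  exact isClosed_le continuous_const (Continuous.matrix_det
    (continuous_matrix fun i j => continuous_const.inner (continuous_apply_frame j)))

section Map

variable {A : Eucl n →L[ℝ] Eucl n}

theorem linearIndependent_map (hA : Function.Injective A) (u : Frame n d) :
    LinearIndependent ℝ fun i => A (u.1 i) :=
  u.2.map' (A : Eucl n →ₗ[ℝ] Eucl n) (LinearMap.ker_eq_bot.2 hA)

theorem map_span (hA : Function.Injective A) (u : Frame n d) :
    map A (span u) = span ⟨fun i => A (u.1 i), linearIndependent_map hA u⟩ :=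
  dif_pos hA

theorem continuousOn_map (U : OGrass n d) :
    ContinuousOn (fun A : Eucl n →L[ℝ] Eucl n => map A U) {A | Function.Injective A} := by
  obtain ⟨u, rfl⟩ := span_surjective U
  rw [continuousOn_iff_continuous_domRestrict]
  let f : {A : Eucl n →L[ℝ] Eucl n | Function.Injective A} → Frame n d := fun A =>
    ⟨fun i => A.1 (u.1 i), linearIndependent_map A.2 u⟩
  have hf : Continuous f := Continuous.subtype_mk (by fun_prop) _
  exact (isOpenQuotientMap_span.continuous.comp hf).congr fun A => (map_span A.2 u).symm

theorem jac_span (A : Eucl n →L[ℝ] Eucl n) (u : Frame n d) :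
    jac A (span u) = √((Matrix.gram ℝ fun i => A (u.1 i)).det / (Matrix.gram ℝ u.1).det) := rfl

theorem jac_nonneg (A : Eucl n →L[ℝ] Eucl n) (U : OGrass n d) : 0 ≤ jac A U := by
  obtain ⟨u, rfl⟩ := span_surjective U
  exact Real.sqrt_nonneg _

theorem jac_pos (hA : Function.Injective A) (U : OGrass n d) : 0 < jac A U := by
  obtain ⟨u, rfl⟩ := span_surjective U
  exact Real.sqrt_pos.2 (div_pos (det_gram_pos ⟨_, linearIndependent_map hA u⟩) (det_gram_pos u))

theorem continuous_jac (U : OGrass n d) :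
    Continuous fun A : Eucl n →L[ℝ] Eucl n => jac A U := by
  obtain ⟨u, rfl⟩ := span_surjective U
  simp only [jac_span]
  refine Real.continuous_sqrt.comp (Continuous.div_const (Continuous.matrix_det ?_) _)
  refine continuous_matrix fun i j => ?_
  simp only [Matrix.gram_apply]
  fun_prop

end Map

end OGrass

/-! ### Discrete varifolds -/

section Dirac

variable {α β ι : Type*} [MeasurableSpace α] [MeasurableSingletonClass α] [Fintype ι]

theorem map_sum_smul_dirac [MeasurableSpace β] [MeasurableSingletonClass β] (f : α → β)
    (c : ι → ENNReal) (z : ι → α) :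
    (∑ i, c i • Measure.dirac (z i)).map f = ∑ i, c i • Measure.dirac (f (z i)) := by
  have hf : AEMeasurable f (∑ i, c i • Measure.dirac (z i)) := by
    rw [← Measure.sum_fintype]
    exact AEMeasurable.sum_measure fun i => aemeasurable_dirac.smul_measure _
  rw [Measure.map_finset_sum' hf]
  simp only [Measure.map_smul, Measure.map_dirac]

theorem withDensity_sum_smul_dirac (f : α → ENNReal) (c : ι → ENNReal) (z : ι → α) :
    (∑ i, c i • Measure.dirac (z i)).withDensity f =
      ∑ i, (c i * f (z i)) • Measure.dirac (z i) := by
  rw [← Measure.sum_fintype, withDensity_sum, Measure.sum_fintype]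
  simp only [withDensity_smul_measure, dirac_withDensity, smul_smul]

end Dirac

section DiscreteVarifold

variable {n d N : ℕ} {r : Fin N → ℝ} {x : Fin N → Eucl n} {U : Fin N → OGrass n d}

instance isFiniteMeasure_discreteVarifold : IsFiniteMeasure (discreteVarifold r x U) := by
  refine ⟨?_⟩
  rw [discreteVarifold, Measure.finsetSum_apply]
  simp

theorem integral_discreteVarifold (hr : ∀ i, 0 ≤ r i) (f : VSpace n d → ℝ) :
    ∫ z, f z ∂discreteVarifold r x U = ∑ i, r i * f (x i, U i) := by
  rw [discreteVarifold, integral_finsetSum_measure fun i _ =>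
    (integrable_dirac (by simp)).smul_measure ENNReal.ofReal_ne_top]
  refine Finset.sum_congr rfl fun i _ => ?_
  rw [integral_smul_measure, integral_dirac, ENNReal.toReal_ofReal (hr i), smul_eq_mul]

theorem weight_discreteVarifold :
    weight (discreteVarifold r x U) = ∑ i, ENNReal.ofReal (r i) • Measure.dirac (x i) :=
  map_sum_smul_dirac _ _ _

theorem weight_discreteVarifold_singleton_ne_zero {i : Fin N} (hr : 0 < r i) :
    weight (discreteVarifold r x U) {x i} ≠ 0 := by
  rw [weight_discreteVarifold, Measure.finsetSum_apply]
  intro h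
  simpa [hr.not_ge] using Finset.sum_eq_zero_iff.1 h i (Finset.mem_univ i)

theorem ae_weight_discreteVarifold {p : Eucl n → Prop} (h : ∀ i, p (x i)) :
    ∀ᵐ y ∂weight (discreteVarifold r x U), p y := by
  rw [weight_discreteVarifold, ae_finsetSum_measure_iff]
  refine fun i _ => Measure.ae_smul_measure ?_ _
  simpa only [ae_dirac_eq, eventually_pure] using h i

theorem metaAction_discreteVarifold (hr : ∀ i, 0 ≤ r i) (φ : Eucl n → Eucl n) {α : Eucl n → ℝ}
    (hα : ∀ y, 0 ≤ α y) :
    metaAction φ α (discreteVarifold r x U) = discreteVarifold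
      (fun i => r i * α (x i) * OGrass.jac (fderiv ℝ φ (x i)) (U i)) (fun i => φ (x i))
      fun i => OGrass.map (fderiv ℝ φ (x i)) (U i) := by
  rw [metaAction, varifoldPush, rescale, discreteVarifold, withDensity_sum_smul_dirac,
    withDensity_sum_smul_dirac, map_sum_smul_dirac]
  refine Finset.sum_congr rfl fun i _ => ?_
  rw [ENNReal.ofReal_mul (mul_nonneg (hr i) (hα _)), ENNReal.ofReal_mul (hr i)]

theorem isFiniteMeasure_metaAction_discreteVarifold (hr : ∀ i, 0 ≤ r i) (φ : Eucl n → Eucl n)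
    {α : Eucl n → ℝ} (hα : ∀ y, 0 ≤ α y) :
    IsFiniteMeasure (metaAction φ α (discreteVarifold r x U)) := by
  rw [metaAction_discreteVarifold hr φ hα]
  infer_instance

theorem integral_metaAction_discreteVarifold (hr : ∀ i, 0 ≤ r i) (φ : Eucl n → Eucl n)
    {α : Eucl n → ℝ} (hα : ∀ y, 0 ≤ α y) (f : VSpace n d → ℝ) :
    ∫ z, f z ∂metaAction φ α (discreteVarifold r x U) =
      ∑ i, r i * α (x i) * OGrass.jac (fderiv ℝ φ (x i)) (U i) *
        f (φ (x i), OGrass.map (fderiv ℝ φ (x i)) (U i)) := by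
  rw [metaAction_discreteVarifold hr φ hα, integral_discreteVarifold fun i =>
    mul_nonneg (mul_nonneg (hr i) (hα _)) (OGrass.jac_nonneg _ _)]

end DiscreteVarifold

/-! ### Dual distances -/

/-- Continuous embedding of a reproducing kernel Hilbert space `W` in the bounded continuous
functions on `X`, the only property of a kernel metric that the direct method uses. -/
structure EmbedsCb {X : Type*} [TopologicalSpace X] (W : Type*) [NormedAddCommGroup W]
    [InnerProductSpace ℝ W] [RKHS ℝ W X ℝ] : Prop where
  continuous (ω : W) : Continuous (ω : X → ℝ)
  exists_bound : ∃ c : ℝ, ∀ (ω : W) (z : X), |ω z| ≤ c * ‖ω‖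

section Dual

variable {n d : ℕ} {W : Type*} [NormedAddCommGroup W] [InnerProductSpace ℝ W]
  [RKHS ℝ W (VSpace n d) ℝ]

theorem EmbedsC10.embedsCb (hW : EmbedsC10 (n := n) (d := d) W) : EmbedsCb W where
  continuous ω := by
    have hopen : IsOpenQuotientMap (Prod.map id OGrass.span : Eucl n × Frame n d → VSpace n d) :=
      .prodMap .id OGrass.isOpenQuotientMap_span
    have hmaps (p : Eucl n × Frame n d) : (p.1, p.2.1) ∈
      {q : Eucl n × (Fin d → Eucl n) | LinearIndependent ℝ q.2} := p.2.2
    refine hopen.continuous_comp_iff.1 (((hW.1 ω).1.continuousOn.comp_continuous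
      (by fun_prop) hmaps).congr fun p => ?_)
    exact dif_pos p.2.2
  exists_bound := hW.2.imp fun _ hc ω z => (hc ω z.1).1 z.2

namespace EmbedsCb

variable (hW : EmbedsCb (X := VSpace n d) W) (μ ν : Measure (VSpace n d)) [IsFiniteMeasure μ]
  [IsFiniteMeasure ν]
include hW

theorem le_dualDist {ω : W} (hω : ‖ω‖ ≤ 1) :
    (∫ z, ω z ∂ν) - ∫ z, ω z ∂μ ≤ dualDist W μ ν := by
  obtain ⟨c, hc⟩ := hW.exists_bound
  have hbound (ω : {ω : W // ‖ω‖ ≤ 1}) (ρ : Measure (VSpace n d)) [IsFiniteMeasure ρ] :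
      |∫ z, ω.1 z ∂ρ| ≤ |c| * ρ.real univ := by
    have hω (z) : ‖ω.1 z‖ ≤ |c| := calc
      |ω.1 z| ≤ c * ‖ω.1‖ := hc ω.1 z
      _ ≤ |c| * ‖ω.1‖ := by gcongr; exact le_abs_self c
      _ ≤ |c| := mul_le_of_le_one_right (abs_nonneg c) ω.2
    exact norm_integral_le_of_norm_le_const (ae_of_all _ hω)
  refine le_ciSup (f := fun ω : {ω : W // ‖ω‖ ≤ 1} => (∫ z, ω.1 z ∂ν) - ∫ z, ω.1 z ∂μ)
    ⟨|c| * ν.real univ + |c| * μ.real univ, ?_⟩ ⟨ω, hω⟩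
  rintro _ ⟨ω, rfl⟩
  exact (le_abs_self _).trans ((abs_sub _ _).trans (add_le_add (hbound ω ν) (hbound ω μ)))

theorem dualDist_nonneg : 0 ≤ dualDist W μ ν := by
  simpa using hW.le_dualDist μ ν (ω := 0) (by simp)

omit [IsFiniteMeasure μ] in
theorem dualDist_le_of_tendsto {ι : Type*} {l : Filter ι} [l.NeBot]
    {ρ : ι → Measure (VSpace n d)} [∀ i, IsFiniteMeasure (ρ i)]
    (hρ : ∀ ω : W, Tendsto (fun i => ∫ z, ω z ∂ρ i) l (𝓝 (∫ z, ω z ∂μ))) {q : ℝ}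
    (hq : Tendsto (fun i => dualDist W (ρ i) ν) l (𝓝 q)) : dualDist W μ ν ≤ q := by
  have : Nonempty {ω : W // ‖ω‖ ≤ 1} := ⟨⟨0, by simp⟩⟩
  exact ciSup_le fun ω => le_of_tendsto_of_tendsto (tendsto_const_nhds.sub (hρ ω.1)) hq
    (Eventually.of_forall fun i => hW.le_dualDist (ρ i) ν ω.2)

end EmbedsCb

end Dual

/-! ### Evaluation at atoms -/

section Atom

variable {X : Type*} [MeasurableSpace X] {ρ : Measure X} {a : X}

theorem apply_of_ae_of_measure_singleton_ne_zero (ha : ρ {a} ≠ 0) {p : X → Prop}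
    (h : ∀ᵐ y ∂ρ, p y) : p a := by
  by_contra hp
  exact ha (measure_mono_null (singleton_subset_iff.2 hp) h)

variable [MeasurableSingletonClass X] [IsFiniteMeasure ρ]

theorem exists_clm_eq_apply_atom (ha : ρ {a} ≠ 0) :
    ∃ T : Lp ℝ 2 ρ →L[ℝ] ℝ, ∀ g : Lp ℝ 2 ρ, T g = g a := by
  have hreal : ρ.real {a} ≠ 0 := ENNReal.toReal_ne_zero.2 ⟨ha, measure_ne_top _ _⟩
  refine ⟨(ρ.real {a})⁻¹ • innerSL ℝ (indicatorConstLp 2 (measurableSet_singleton a)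
    (measure_ne_top ρ {a}) (1 : ℝ)), fun g => ?_⟩
  rw [smul_apply, innerSL_apply_apply, L2.inner_indicatorConstLp_one, integral_singleton,
    smul_eq_mul, smul_eq_mul, inv_mul_cancel_left₀ hreal]

theorem memLp_apply_atom (ha : ρ {a} ≠ 0) (η : L2Time (Lp ℝ 2 ρ)) :
    MemLp (fun s => η s a) 2 (volume.restrict (Icc (0 : ℝ) 1)) := by
  obtain ⟨T, hT⟩ := exists_clm_eq_apply_atom ha
  simp only [← hT]
  exact T.comp_memLp η

theorem exists_L2Time_apply_atom_eq {S : Finset X} (hS : ∀ a ∈ S, ρ {a} ≠ 0)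
    {f : X → ℝ → ℝ} (hf : ∀ a ∈ S, ContinuousOn (f a) (Icc 0 1)) :
    ∃ η : L2Time (Lp ℝ 2 ρ), ∀ a ∈ S, ∀ᵐ t ∂volume.restrict (Icc (0 : ℝ) 1), η t a = f a t := by
  let e (b : X) : Lp ℝ 2 ρ :=
    indicatorConstLp 2 (measurableSet_singleton b) (measure_ne_top ρ {b}) (1 : ℝ)
  let g (t : ℝ) : Lp ℝ 2 ρ := ∑ b ∈ S, f b t • e b
  have hg : ContinuousOn g (Icc 0 1) :=
    continuousOn_finsetSum _ fun b hb => (hf b hb).smul continuousOn_const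
  obtain ⟨B, hB⟩ := isCompact_Icc.exists_bound_of_continuousOn hg
  have hmem : MemLp g 2 (volume.restrict (Icc (0 : ℝ) 1)) :=
    MemLp.of_bound (hg.aestronglyMeasurable measurableSet_Icc) B
      ((ae_restrict_iff' measurableSet_Icc).2 (ae_of_all _ hB))
  refine ⟨hmem.toLp g, fun a ha => ?_⟩
  obtain ⟨T, hT⟩ := exists_clm_eq_apply_atom (hS a ha)
  have he (b : X) : T (e b) = indicator {b} (fun _ => (1 : ℝ)) a :=
    (hT (e b)).trans (apply_of_ae_of_measure_singleton_ne_zero (hS a ha) indicatorConstLp_coeFn)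
  filter_upwards [hmem.coeFn_toLp] with t ht
  rw [ht, ← hT, map_sum, Finset.sum_eq_single_of_mem a ha fun b _ hb => by simp [he, hb.symm]]
  simp [he]

end Atom

theorem alphaTilde_apply_atom {n : ℕ} {ρ : Measure (Eucl n)} [IsFiniteMeasure ρ]
    {a : Eucl n} (ha : ρ {a} ≠ 0) (η : L2Time (Lp ℝ 2 ρ)) {t : ℝ} (ht : t ∈ Icc (0 : ℝ) 1) :
    alphaTilde η t a = 1 + 1 / 2 * ∫ s in (0 : ℝ)..t, η s a := by
  obtain ⟨T, hT⟩ := exists_clm_eq_apply_atom ha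
  have hint : IntervalIntegrable (fun s => η s) volume 0 t :=
    intervalIntegrable_of_mem_Icc ((Lp.memLp η).integrable one_le_two)
      (left_mem_Icc.2 zero_le_one) ht
  rw [alphaTilde, ← hT, ← T.intervalIntegral_comp_comm hint]
  simp only [hT]

/-! ### Uniform limits and weighted integrals -/

theorem tendstoUniformlyOn_comp_of_continuousAt {ι α β γ : Type*} [TopologicalSpace α]
    [UniformSpace β] [UniformSpace γ] {F : ι → α → β} {f : α → β} {l : Filter ι} {K : Set α}
    {g : β → γ} (h : TendstoUniformlyOn F f l K) (hK : IsCompact K) (hf : ContinuousOn f K)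
    (hg : ∀ x ∈ K, ContinuousAt g (f x)) :
    TendstoUniformlyOn (fun i x => g (F i x)) (fun x => g (f x)) l K := by
  rw [← tendstoLocallyUniformlyOn_iff_tendstoUniformlyOn_of_compact hK,
    tendstoLocallyUniformlyOn_iff_forall_tendsto] at h ⊢
  intro x hx
  have hfx : Tendsto (fun y : ι × α => f y.2) (l ×ˢ 𝓝[K] x) (𝓝 (f x)) :=
    (hf x hx).tendsto.comp tendsto_snd
  have hFx : Tendsto (fun y : ι × α => F y.1 y.2) (l ×ˢ 𝓝[K] x) (𝓝 (f x)) :=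
    (Uniform.tendsto_congr (h x hx)).1 hfx
  exact (((hg x hx).tendsto.comp hfx).prodMk_nhds ((hg x hx).tendsto.comp hFx)).mono_right
    (nhds_le_uniformity _)

theorem tendsto_intervalIntegral_of_tendstoUniformlyOn {ι : Type*} {l : Filter ι} {a b : ℝ}
    {F : ι → ℝ → ℝ} {f : ℝ → ℝ} (h : TendstoUniformlyOn F f l (uIcc a b))
    (hF : ∀ i, ContinuousOn (F i) (uIcc a b)) (hf : ContinuousOn f (uIcc a b)) :
    Tendsto (fun i => ∫ t in a..b, F i t) l (𝓝 (∫ t in a..b, f t)) := by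
  rw [Metric.tendsto_nhds]
  intro ε hε
  filter_upwards [Metric.tendstoUniformlyOn_iff.1 h (ε / (|b - a| + 1)) (by positivity)] with i hi
  rw [dist_eq_norm, ← intervalIntegral.integral_sub (hF i).intervalIntegrable
    hf.intervalIntegrable]
  have hdist : ∀ t ∈ uIoc a b, ‖F i t - f t‖ ≤ ε / (|b - a| + 1) := fun t ht => by
    simpa only [dist_comm, dist_eq_norm] using (hi t (uIoc_subset_uIcc ht)).le
  calc ‖∫ t in a..b, F i t - f t‖ ≤ ε / (|b - a| + 1) * |b - a| :=
        intervalIntegral.norm_integral_le_of_norm_le_const hdist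
    _ < ε := by
        rw [div_mul_eq_mul_div, div_lt_iff₀ (by positivity)]
        gcongr
        exact lt_add_one _

theorem sq_integral_le_integral_sq_mul {X : Type*} [MeasurableSpace X] {ν : Measure X}
    {h J : X → ℝ} (hh : AEStronglyMeasurable h ν) (hhJ : Integrable (fun x => h x ^ 2 * J x) ν)
    (hJ : Integrable (fun x => (J x)⁻¹) ν) (hpos : ∀ᵐ x ∂ν, 0 < J x) :
    (∫ x, h x ∂ν) ^ 2 ≤ (∫ x, h x ^ 2 * J x ∂ν) * ∫ x, (J x)⁻¹ ∂ν := by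
  have hJm : AEMeasurable J ν := by
    simpa only [inv_inv] using hJ.aemeasurable.fun_inv
  have hsq : (fun x => (h x * √(J x)) ^ 2) =ᵐ[ν] fun x => h x ^ 2 * J x :=
    hpos.mono fun x hx => by simp only [mul_pow, Real.sq_sqrt hx.le]
  have hsq' : (fun x => (√(J x))⁻¹ ^ 2) =ᵐ[ν] fun x => (J x)⁻¹ :=
    hpos.mono fun x hx => by simp only [inv_pow, Real.sq_sqrt hx.le]
  have hmul : (fun x => h x * √(J x) * (√(J x))⁻¹) =ᵐ[ν] h :=
    hpos.mono fun x hx => mul_inv_cancel_right₀ (Real.sqrt_pos.2 hx).ne' _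
  have hL2 : MemLp (fun x => h x * √(J x)) 2 ν :=
    (memLp_two_iff_integrable_sq (hh.mul hJm.sqrt.aestronglyMeasurable)).2
      (hhJ.congr hsq.symm)
  have hL2' : MemLp (fun x => (√(J x))⁻¹) 2 ν :=
    (memLp_two_iff_integrable_sq hJm.sqrt.inv.aestronglyMeasurable).2 (hJ.congr hsq'.symm)
  simpa only [integral_congr_ae hsq, integral_congr_ae hsq', integral_congr_ae hmul] using
    sq_integral_mul_le hL2 hL2'

/-! ### The reduced problem -/

section Reduced

variable {n d N : ℕ} (r : Fin N → ℝ) (x : Fin N → Eucl n) (U : Fin N → OGrass n d)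

open Classical in
/-- The support of the weight of a discrete varifold with positive masses; several of the points
`x i` may coincide, with different tangent spaces. -/
def atoms : Finset (Eucl n) := Finset.univ.image x

open Classical in
/-- The mass at the image of the atom `a` under a deformation with differential `A` at `a`. -/
def atomMass (a : Eucl n) (A : Eucl n →L[ℝ] Eucl n) : ℝ :=
  ∑ i with x i = a, r i * OGrass.jac A (U i)

variable {V : Type*} [NormedAddCommGroup V] [InnerProductSpace ℝ V] [RKHS ℝ V (Eucl n) (Eucl n)]
  (W : Type*) [NormedAddCommGroup W] [InnerProductSpace ℝ W] [RKHS ℝ W (VSpace n d) ℝ]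
  (γ lam : ℝ) (μtar : Measure (VSpace n d)) (v : L2Time V)

/-- The mass `J_t` at the image of the atom `a` under the flow of `v` at time `t`. -/
def flowMass (a : Eucl n) (t : ℝ) : ℝ := atomMass r x U a (fderiv ℝ (flowMap v t) a)

/-- The integral `∫₀¹ dt / J_t` of the inverse mass at the atom `a` along the flow of `v`: optimal
weights are affine functions of `∫₀ᵗ ds / J_s`. -/
def flowTime (a : Eucl n) : ℝ := ∫ t in (0 : ℝ)..1, (flowMass r x U v a t)⁻¹

/-- The dual distance to the target after the action of the flow of `v` and the weights `β²`. -/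
def endDist (β : Eucl n → ℝ) : ℝ :=
  dualDist W (metaAction (flowMap v 1) (fun y => β y ^ 2) (discreteVarifold r x U)) μtar

/-- The reduced functional: the least relaxed cost of the weight changes with final value `β`. -/
def reducedCost (β : Eucl n → ℝ) : ℝ :=
  1 / 2 * ‖v‖ ^ 2 + ∑ a ∈ atoms x, 2 * γ * ((β a - 1) ^ 2 / flowTime r x U v a) +
    lam / 2 * endDist r x U W μtar v β ^ 2

variable {r x U} {W γ lam μtar} {a : Eucl n}

theorem mem_atoms : a ∈ atoms x ↔ ∃ i, x i = a := by simp [atoms]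

theorem weight_discreteVarifold_atom_ne_zero (hr : ∀ i, 0 < r i) (ha : a ∈ atoms x) :
    weight (discreteVarifold r x U) {a} ≠ 0 := by
  obtain ⟨i, rfl⟩ := mem_atoms.1 ha
  exact weight_discreteVarifold_singleton_ne_zero (hr i)

theorem atomMass_pos (hr : ∀ i, 0 < r i) (ha : a ∈ atoms x) {A : Eucl n →L[ℝ] Eucl n}
    (hA : Function.Injective A) : 0 < atomMass r x U a A := by
  classical
  obtain ⟨i, rfl⟩ := mem_atoms.1 ha
  exact Finset.sum_pos (fun j _ => mul_pos (hr j) (OGrass.jac_pos hA _))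
    ⟨i, Finset.mem_filter.2 ⟨Finset.mem_univ i, rfl⟩⟩

theorem continuous_atomMass : Continuous (atomMass r x U a) :=
  continuous_finsetSum _ fun _ _ => continuous_const.mul (OGrass.continuous_jac _)

theorem sum_mul_jac_eq_sum_atomMass (g : Eucl n → ℝ) (A : Eucl n → Eucl n →L[ℝ] Eucl n) :
    ∑ i, r i * (g (x i) * OGrass.jac (A (x i)) (U i)) =
      ∑ a ∈ atoms x, g a * atomMass r x U a (A a) := by
  classical
  rw [← Finset.sum_fiberwise_of_maps_to (t := atoms x) (g := x) fun i _ => mem_atoms.2 ⟨i, rfl⟩]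
  refine Finset.sum_congr rfl fun a _ => ?_
  rw [atomMass, Finset.mul_sum]
  refine Finset.sum_congr (by congr) fun i hi => ?_
  rw [(Finset.mem_filter.1 hi).2]
  ring

theorem endDist_congr (hr : ∀ i, 0 ≤ r i) {β β' : Eucl n → ℝ}
    (h : ∀ a ∈ atoms x, β a ^ 2 = β' a ^ 2) :
    endDist r x U W μtar v β = endDist r x U W μtar v β' := by
  simp only [endDist, metaAction_discreteVarifold hr _ fun _ => sq_nonneg _,
    h _ (mem_atoms.2 ⟨_, rfl⟩)]

theorem endDist_nonneg [IsFiniteMeasure μtar] (hr : ∀ i, 0 ≤ r i)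
    (hW : EmbedsCb (X := VSpace n d) W) (β : Eucl n → ℝ) : 0 ≤ endDist r x U W μtar v β :=
  have := isFiniteMeasure_metaAction_discreteVarifold (x := x) (U := U) hr (flowMap v 1)
    fun y => sq_nonneg (β y)
  hW.dualDist_nonneg _ _

end Reduced

namespace EmbedsC11

variable {n d N : ℕ} {r : Fin N → ℝ} {x : Fin N → Eucl n} {U : Fin N → OGrass n d}
  {V : Type*} [NormedAddCommGroup V] [InnerProductSpace ℝ V] [RKHS ℝ V (Eucl n) (Eucl n)] {c : ℝ}
  {W : Type*} [NormedAddCommGroup W] [InnerProductSpace ℝ W] [RKHS ℝ W (VSpace n d) ℝ]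
  {γ lam : ℝ} {μtar : Measure (VSpace n d)} (hV : EmbedsC11 V c) (v : L2Time V) {a : Eucl n}
include hV

theorem flowMass_pos (hr : ∀ i, 0 < r i) (ha : a ∈ atoms x) {t : ℝ} (ht : t ∈ Icc (0 : ℝ) 1) :
    0 < flowMass r x U v a t :=
  atomMass_pos hr ha (hV.injective_fderiv_flowMap v a ht)

theorem continuousOn_flowMass : ContinuousOn (flowMass r x U v a) (Icc 0 1) :=
  continuous_atomMass.comp_continuousOn (hV.continuousOn_fderiv_flowMap v a)

theorem continuousOn_inv_flowMass (hr : ∀ i, 0 < r i) (ha : a ∈ atoms x) :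
    ContinuousOn (fun t => (flowMass r x U v a t)⁻¹) (Icc 0 1) :=
  (hV.continuousOn_flowMass v).inv₀ fun _ ht => (hV.flowMass_pos v hr ha ht).ne'

theorem flowTime_pos (hr : ∀ i, 0 < r i) (ha : a ∈ atoms x) : 0 < flowTime r x U v a :=
  intervalIntegral.intervalIntegral_pos_of_pos_on
    (intervalIntegrable_of_mem_Icc ((hV.continuousOn_inv_flowMass v hr ha).integrableOn_Icc)
      (left_mem_Icc.2 zero_le_one) (right_mem_Icc.2 zero_le_one))
    (fun _ ht => inv_pos.2 (hV.flowMass_pos v hr ha (Ioo_subset_Icc_self ht))) zero_lt_one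

theorem integral_inv_flowMass_div_flowTime_mem_Icc (hr : ∀ i, 0 < r i) (ha : a ∈ atoms x) {t : ℝ}
    (ht : t ∈ Icc (0 : ℝ) 1) :
    (∫ s in (0 : ℝ)..t, (flowMass r x U v a s)⁻¹) / flowTime r x U v a ∈ Icc (0 : ℝ) 1 := by
  have hnonneg : ∀ s ∈ Icc (0 : ℝ) 1, 0 ≤ (flowMass r x U v a s)⁻¹ := fun s hs =>
    (inv_pos.2 (hV.flowMass_pos v hr ha hs)).le
  have hT := hV.flowTime_pos (U := U) v hr ha
  refine ⟨div_nonneg (intervalIntegral.integral_nonneg ht.1 fun s hs =>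
    hnonneg s ⟨hs.1, hs.2.trans ht.2⟩) hT.le, (div_le_one hT).2 ?_⟩
  refine intervalIntegral.integral_mono_interval le_rfl ht.1 ht.2
    ((ae_restrict_iff' measurableSet_Ioc).2
      (ae_of_all _ fun s hs => hnonneg s (Ioc_subset_Icc_self hs))) ?_
  exact intervalIntegrable_of_mem_Icc (hV.continuousOn_inv_flowMass v hr ha).integrableOn_Icc
    (left_mem_Icc.2 zero_le_one) (right_mem_Icc.2 zero_le_one)

theorem sq_integral_div_flowTime_le (hr : ∀ i, 0 < r i) (ha : a ∈ atoms x) {h : ℝ → ℝ}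
    (hh : MemLp h 2 (volume.restrict (Icc (0 : ℝ) 1))) :
    (∫ t in (0 : ℝ)..1, h t) ^ 2 / flowTime r x U v a ≤
      ∫ t in (0 : ℝ)..1, h t ^ 2 * flowMass r x U v a t := by
  rw [div_le_iff₀ (hV.flowTime_pos v hr ha), flowTime]
  simp only [intervalIntegral.integral_of_le zero_le_one, ← integral_Icc_eq_integral_Ioc]
  exact sq_integral_le_integral_sq_mul hh.aestronglyMeasurable
    (IntegrableOn.mul_continuousOn hh.integrable_sq (hV.continuousOn_flowMass v) isCompact_Icc)
    (hV.continuousOn_inv_flowMass v hr ha).integrableOn_Icc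
    ((ae_restrict_iff' measurableSet_Icc).2 (ae_of_all _ fun _ => hV.flowMass_pos v hr ha))

theorem relaxedCost_eq (hr : ∀ i, 0 < r i)
    (η : L2Time (Lp ℝ 2 (weight (discreteVarifold r x U)))) :
    relaxedCost W γ lam (discreteVarifold r x U) μtar v η =
      1 / 2 * ‖v‖ ^ 2 +
      ∑ a ∈ atoms x, γ / 2 * (∫ t in (0 : ℝ)..1, η t a ^ 2 * flowMass r x U v a t) +
      lam / 2 * endDist r x U W μtar v (alphaTilde η 1) ^ 2 := by
  have hint : ∀ a ∈ atoms x,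
      IntervalIntegrable (fun t => η t a ^ 2 * flowMass r x U v a t) volume 0 1 := fun a ha =>
    intervalIntegrable_of_mem_Icc (IntegrableOn.mul_continuousOn
      (memLp_apply_atom (weight_discreteVarifold_atom_ne_zero hr ha) η).integrable_sq
      (hV.continuousOn_flowMass v) isCompact_Icc)
      (left_mem_Icc.2 zero_le_one) (right_mem_Icc.2 zero_le_one)
  have hsum (t : ℝ) : ∑ i, r i * (η t (x i) ^ 2 *
      OGrass.jac (fderiv ℝ (flowMap v t) (x i)) (U i)) =
        ∑ a ∈ atoms x, η t a ^ 2 * flowMass r x U v a t :=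
    sum_mul_jac_eq_sum_atomMass (fun y => η t y ^ 2) fun y => fderiv ℝ (flowMap v t) y
  rw [relaxedCost, L2Time.integral_sq_norm, ← Finset.mul_sum,
    ← intervalIntegral.integral_finsetSum hint]
  simp only [integral_discreteVarifold fun i => (hr i).le, hsum]
  rfl

theorem reducedCost_alphaTilde_le (hr : ∀ i, 0 < r i) (hγ : 0 ≤ γ)
    (η : L2Time (Lp ℝ 2 (weight (discreteVarifold r x U)))) :
    reducedCost r x U W γ lam μtar v (alphaTilde η 1) ≤
      relaxedCost W γ lam (discreteVarifold r x U) μtar v η := by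
  rw [hV.relaxedCost_eq v hr, reducedCost]
  gcongr _ + ?_ + _
  refine Finset.sum_le_sum fun a ha => ?_
  have hρ := weight_discreteVarifold_atom_ne_zero (U := U) hr ha
  calc 2 * γ * ((alphaTilde η 1 a - 1) ^ 2 / flowTime r x U v a)
      = γ / 2 * ((∫ t in (0 : ℝ)..1, η t a) ^ 2 / flowTime r x U v a) := by
        rw [alphaTilde_apply_atom hρ η (right_mem_Icc.2 zero_le_one)]
        ring
    _ ≤ γ / 2 * ∫ t in (0 : ℝ)..1, η t a ^ 2 * flowMass r x U v a t := by
        gcongr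
        exact hV.sq_integral_div_flowTime_le v hr ha (memLp_apply_atom hρ η)

theorem reducedCost_abs_le (hr : ∀ i, 0 < r i) (hγ : 0 ≤ γ) (β : Eucl n → ℝ) :
    reducedCost r x U W γ lam μtar v (fun y => |β y|) ≤ reducedCost r x U W γ lam μtar v β := by
  rw [reducedCost, reducedCost, endDist_congr v (fun i => (hr i).le) fun a _ => sq_abs (β a)]
  gcongr _ + ?_ + _
  refine Finset.sum_le_sum fun a ha => ?_
  have hT := (hV.flowTime_pos (U := U) v hr ha).le
  have habs : (|β a| - 1) ^ 2 ≤ (β a - 1) ^ 2 := by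
    simpa using sq_le_sq.2 (abs_abs_sub_abs_le (β a) 1)
  gcongr

end EmbedsC11

/-! ### Optimal weight changes -/

section OptimalRate

variable {n d N : ℕ} {r : Fin N → ℝ} {x : Fin N → Eucl n} {U : Fin N → OGrass n d}
  {V : Type*} [NormedAddCommGroup V] [InnerProductSpace ℝ V] [RKHS ℝ V (Eucl n) (Eucl n)] {c : ℝ}
  {W : Type*} [NormedAddCommGroup W] [InnerProductSpace ℝ W] [RKHS ℝ W (VSpace n d) ℝ]
  {v : L2Time V} {β : Eucl n → ℝ} {η : L2Time (Lp ℝ 2 (weight (discreteVarifold r x U)))}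

/-- The rate `η` is, at every atom, the multiple of the inverse mass that leads to the final weight
`β`. It is the equality case of the Cauchy–Schwarz inequality `sq_integral_le_integral_sq_mul`. -/
def IsOptimalRate (v : L2Time V) (β : Eucl n → ℝ)
    (η : L2Time (Lp ℝ 2 (weight (discreteVarifold r x U)))) : Prop :=
  ∀ a ∈ atoms x, ∀ᵐ t ∂volume.restrict (Icc (0 : ℝ) 1),
    η t a = 2 * (β a - 1) / flowTime r x U v a * (flowMass r x U v a t)⁻¹

theorem EmbedsC11.exists_isOptimalRate (hV : EmbedsC11 V c) (hr : ∀ i, 0 < r i) (v : L2Time V)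
    (β : Eucl n → ℝ) :
    ∃ η : L2Time (Lp ℝ 2 (weight (discreteVarifold r x U))), IsOptimalRate v β η :=
  exists_L2Time_apply_atom_eq (fun _ ha => weight_discreteVarifold_atom_ne_zero hr ha)
    fun _ ha => continuousOn_const.mul (hV.continuousOn_inv_flowMass v hr ha)

namespace IsOptimalRate

variable (hη : IsOptimalRate v β η)
include hη

theorem alphaTilde_eq (hr : ∀ i, 0 < r i) {a : Eucl n} (ha : a ∈ atoms x) {t : ℝ}
    (ht : t ∈ Icc (0 : ℝ) 1) :
    alphaTilde η t a = 1 + (β a - 1) *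
      ((∫ s in (0 : ℝ)..t, (flowMass r x U v a s)⁻¹) / flowTime r x U v a) := by
  have hsub : uIoc 0 t ⊆ Icc 0 1 := uIoc_subset_uIcc.trans
    (uIcc_subset_Icc (left_mem_Icc.2 zero_le_one) ht)
  rw [alphaTilde_apply_atom (weight_discreteVarifold_atom_ne_zero hr ha) η ht,
    intervalIntegral.integral_congr_ae_restrict
      (ae_restrict_of_ae_restrict_of_subset hsub (hη a ha)),
    intervalIntegral.integral_const_mul]
  ring

variable (hV : EmbedsC11 V c) (hr : ∀ i, 0 < r i)
include hV hr

theorem alphaTilde_one {a : Eucl n} (ha : a ∈ atoms x) : alphaTilde η 1 a = β a := by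
  rw [hη.alphaTilde_eq hr ha (right_mem_Icc.2 zero_le_one), ← flowTime,
    div_self (hV.flowTime_pos v hr ha).ne']
  ring

theorem alphaTilde_nonneg {a : Eucl n} (ha : a ∈ atoms x) (hβ : 0 ≤ β a) {t : ℝ}
    (ht : t ∈ Icc (0 : ℝ) 1) : 0 ≤ alphaTilde η t a := by
  rw [hη.alphaTilde_eq hr ha ht]
  obtain ⟨hθ₀, hθ₁⟩ := hV.integral_inv_flowMass_div_flowTime_mem_Icc (U := U) v hr ha ht
  linarith [mul_nonneg hβ hθ₀]

theorem integral_sq_mul_flowMass {a : Eucl n} (ha : a ∈ atoms x) :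
    ∫ t in (0 : ℝ)..1, η t a ^ 2 * flowMass r x U v a t =
      4 * ((β a - 1) ^ 2 / flowTime r x U v a) := by
  have hrate : (fun t => η t a ^ 2 * flowMass r x U v a t) =ᵐ[volume.restrict (Icc (0 : ℝ) 1)]
      fun t => (2 * (β a - 1) / flowTime r x U v a) ^ 2 * (flowMass r x U v a t)⁻¹ := by
    filter_upwards [hη a ha, ae_restrict_mem measurableSet_Icc] with t hηt ht
    have hJ := (hV.flowMass_pos (U := U) v hr ha ht).ne'
    rw [hηt]
    field_simp
  have hT := (hV.flowTime_pos (U := U) v hr ha).ne'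
  have hsub : uIoc (0 : ℝ) 1 ⊆ Icc 0 1 := uIoc_subset_uIcc.trans (uIcc_of_le zero_le_one).subset
  rw [intervalIntegral.integral_congr_ae_restrict
    (ae_restrict_of_ae_restrict_of_subset hsub hrate), intervalIntegral.integral_const_mul,
    ← flowTime]
  field_simp
  ring

theorem relaxedCost_eq (γ lam : ℝ) (μtar : Measure (VSpace n d)) :
    relaxedCost W γ lam (discreteVarifold r x U) μtar v η =
      reducedCost r x U W γ lam μtar v β := by
  rw [hV.relaxedCost_eq v hr, reducedCost, endDist_congr v (fun i => (hr i).le) fun a ha =>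
    congrArg (· ^ 2) (hη.alphaTilde_one hV hr ha)]
  congr 2
  refine Finset.sum_congr rfl fun a ha => ?_
  rw [hη.integral_sq_mul_flowMass hV hr ha]
  ring

end IsOptimalRate

end OptimalRate

/-! ### Existence -/

theorem exists_tendsto_of_eventually_mem_Icc {ι : Type*} (l : Ultrafilter ι) {f : ι → ℝ} {a b : ℝ}
    (h : ∀ᶠ i in l, f i ∈ Icc a b) : ∃ y, Tendsto f l (𝓝 y) := by
  obtain ⟨y, -, hy⟩ := isCompact_Icc.ultrafilter_le_nhds' (l.map f) h
  exact ⟨y, hy⟩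

section Existence

variable {n d N : ℕ} {r : Fin N → ℝ} {x : Fin N → Eucl n} {U : Fin N → OGrass n d}
  {V : Type*} [NormedAddCommGroup V] [InnerProductSpace ℝ V] [RKHS ℝ V (Eucl n) (Eucl n)] {c : ℝ}
  {W : Type*} [NormedAddCommGroup W] [InnerProductSpace ℝ W] [RKHS ℝ W (VSpace n d) ℝ]
  {γ lam : ℝ} {μtar : Measure (VSpace n d)}

namespace EmbedsC11

variable (hV : EmbedsC11 V c)
include hV

section WeakConvergence

variable {ι : Type*} {l : Filter ι} {u : ι → L2Time V} {v : L2Time V} {M : ℝ}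
  (hM : ∀ i, ‖u i‖ ≤ M) (huv : TendstoWeakly u l v)
include hM huv

theorem tendsto_flowTime (hr : ∀ i, 0 < r i) {a : Eucl n} (ha : a ∈ atoms x) :
    Tendsto (fun i => flowTime r x U (u i) a) l (𝓝 (flowTime r x U v a)) := by
  refine tendsto_intervalIntegral_of_tendstoUniformlyOn ?_ ?_ ?_ <;> rw [uIcc_of_le zero_le_one]
  · exact tendstoUniformlyOn_comp_of_continuousAt (g := fun A => (atomMass r x U a A)⁻¹)
      (hV.tendstoUniformlyOn_fderiv_flowMap a hM huv) isCompact_Icc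
      (hV.continuousOn_fderiv_flowMap v a) fun _ ht =>
        continuous_atomMass.continuousAt.inv₀ (hV.flowMass_pos v hr ha ht).ne'
  · exact fun i => hV.continuousOn_inv_flowMass (u i) hr ha
  · exact hV.continuousOn_inv_flowMass v hr ha

theorem tendsto_apply_map_flowMap {f : VSpace n d → ℝ} (hf : Continuous f) (y : Eucl n)
    (U : OGrass n d) {t : ℝ} (ht : t ∈ Icc (0 : ℝ) 1) :
    Tendsto (fun i => f (flowMap (u i) t y, OGrass.map (fderiv ℝ (flowMap (u i) t) y) U)) l
      (𝓝 (f (flowMap v t y, OGrass.map (fderiv ℝ (flowMap v t) y) U))) := by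
  have hφ := (hV.tendstoUniformlyOn_flowMap y hM huv).tendsto_at ht
  have hA : Tendsto (fun i => fderiv ℝ (flowMap (u i) t) y) l
      (𝓝[{A | Function.Injective A}] (fderiv ℝ (flowMap v t) y)) :=
    tendsto_nhdsWithin_iff.2 ⟨(hV.tendstoUniformlyOn_fderiv_flowMap y hM huv).tendsto_at ht,
      Eventually.of_forall fun i => hV.injective_fderiv_flowMap (u i) y ht⟩
  have hU := (OGrass.continuousOn_map U _ (hV.injective_fderiv_flowMap v y ht)).tendsto.comp hA
  exact (hf.tendsto _).comp (hφ.prodMk_nhds hU)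

theorem tendsto_integral_metaAction (hr : ∀ i, 0 ≤ r i) {f : VSpace n d → ℝ} (hf : Continuous f)
    {b : ι → Eucl n → ℝ} {β : Eucl n → ℝ}
    (hb : ∀ a ∈ atoms x, Tendsto (fun i => b i a) l (𝓝 (β a))) :
    Tendsto (fun i => ∫ z, f z ∂metaAction (flowMap (u i) 1) (fun y => b i y ^ 2)
        (discreteVarifold r x U)) l
      (𝓝 (∫ z, f z ∂metaAction (flowMap v 1) (fun y => β y ^ 2) (discreteVarifold r x U))) := by
  simp only [integral_metaAction_discreteVarifold hr _ fun _ => sq_nonneg _]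
  refine tendsto_finsetSum _ fun i _ => ?_
  have ht : (1 : ℝ) ∈ Icc (0 : ℝ) 1 := right_mem_Icc.2 zero_le_one
  have hjac := ((OGrass.continuous_jac (U i)).tendsto _).comp
    ((hV.tendstoUniformlyOn_fderiv_flowMap (x i) hM huv).tendsto_at ht)
  exact ((((hb _ (mem_atoms.2 ⟨i, rfl⟩)).pow 2).const_mul _).mul hjac).mul
    (hV.tendsto_apply_map_flowMap hM huv hf (x i) (U i) ht)

end WeakConvergence

section Bounds

variable (hr : ∀ i, 0 < r i) (hγ : 0 ≤ γ) (hlam : 0 ≤ lam) (v : L2Time V) (β : Eucl n → ℝ)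
include hr hγ

theorem mul_sq_div_flowTime_nonneg {a : Eucl n} (ha : a ∈ atoms x) :
    0 ≤ 2 * γ * ((β a - 1) ^ 2 / flowTime r x U v a) :=
  mul_nonneg (by positivity) (div_nonneg (sq_nonneg _) (hV.flowTime_pos v hr ha).le)

theorem sum_mul_sq_div_flowTime_nonneg :
    0 ≤ ∑ a ∈ atoms x, 2 * γ * ((β a - 1) ^ 2 / flowTime r x U v a) :=
  Finset.sum_nonneg fun _ ha => hV.mul_sq_div_flowTime_nonneg hr hγ v β ha

theorem mul_sq_endDist_le_reducedCost :
    lam / 2 * endDist r x U W μtar v β ^ 2 ≤ reducedCost r x U W γ lam μtar v β :=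
  le_add_of_nonneg_left
    (add_nonneg (by positivity) (hV.sum_mul_sq_div_flowTime_nonneg hr hγ v β))

include hlam

theorem half_sq_norm_le_reducedCost :
    1 / 2 * ‖v‖ ^ 2 ≤ reducedCost r x U W γ lam μtar v β :=
  le_add_of_le_of_nonneg
    (le_add_of_nonneg_right (hV.sum_mul_sq_div_flowTime_nonneg hr hγ v β)) (by positivity)

theorem norm_le_sqrt_of_reducedCost_le {C : ℝ}
    (hC : reducedCost r x U W γ lam μtar v β ≤ C) : ‖v‖ ≤ √(2 * C) :=
  Real.le_sqrt_of_sq_le <| by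
    linarith [(hV.half_sq_norm_le_reducedCost hr hγ hlam v β).trans hC]

theorem mul_sq_div_flowTime_le_reducedCost {a : Eucl n} (ha : a ∈ atoms x) :
    2 * γ * ((β a - 1) ^ 2 / flowTime r x U v a) ≤ reducedCost r x U W γ lam μtar v β :=
  le_add_of_le_of_nonneg (le_add_of_nonneg_of_le (by positivity)
    (Finset.single_le_sum (fun _ hb => hV.mul_sq_div_flowTime_nonneg hr hγ v β hb) ha))
    (by positivity)

end Bounds

variable {ι : Type*} (l : Ultrafilter ι) {u : ι → L2Time V} {b : ι → Eucl n → ℝ}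

theorem exists_tendsto_of_forall_reducedCost_le [CompleteSpace V] (hr : ∀ i, 0 < r i) (hγ : 0 < γ)
    (hlam : 0 ≤ lam) {C : ℝ} (hC : ∀ i, reducedCost r x U W γ lam μtar (u i) (b i) ≤ C) :
    ∃ (v : L2Time V) (β : Eucl n → ℝ), TendstoWeakly u l v ∧
      ∀ a ∈ atoms x, Tendsto (fun i => b i a) l (𝓝 (β a)) := by
  have hM (i : ι) := hV.norm_le_sqrt_of_reducedCost_le hr hγ.le hlam (u i) (b i) (hC i)
  obtain ⟨v, huv⟩ := exists_tendstoWeakly l hM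
  suffices ∀ a ∈ atoms x, ∃ y, Tendsto (fun i => b i a) l (𝓝 y) by
    choose! β hβ using this
    exact ⟨v, β, huv, hβ⟩
  intro a ha
  have hT := hV.tendsto_flowTime (U := U) hM huv hr ha
  refine exists_tendsto_of_eventually_mem_Icc l (a := 1 - √(C / (2 * γ) * (flowTime r x U v a + 1)))
    (b := 1 + √(C / (2 * γ) * (flowTime r x U v a + 1))) ?_
  filter_upwards [hT.eventually (gt_mem_nhds (lt_add_one _))] with i hi
  have hTi := hV.flowTime_pos (U := U) (u i) hr ha
  have hterm : (b i a - 1) ^ 2 / flowTime r x U (u i) a ≤ C / (2 * γ) := by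
    rw [le_div_iff₀' (by positivity)]
    exact (hV.mul_sq_div_flowTime_le_reducedCost hr hγ.le hlam (u i) (b i) ha).trans (hC i)
  have hsq : (b i a - 1) ^ 2 ≤ C / (2 * γ) * (flowTime r x U v a + 1) :=
    ((div_le_iff₀ hTi).1 hterm).trans (mul_le_mul_of_nonneg_left hi.le
      ((div_nonneg (sq_nonneg _) hTi.le).trans hterm))
  obtain ⟨hlower, hupper⟩ := abs_le.1 (Real.abs_le_sqrt hsq)
  constructor <;> linarith

theorem endDist_le_of_tendsto [IsFiniteMeasure μtar] (hr : ∀ i, 0 ≤ r i)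
    (hW : EmbedsCb (X := VSpace n d) W) {v : L2Time V} {β : Eucl n → ℝ} {M q : ℝ}
    (hM : ∀ i, ‖u i‖ ≤ M) (huv : TendstoWeakly u l v)
    (hb : ∀ a ∈ atoms x, Tendsto (fun i => b i a) l (𝓝 (β a)))
    (hq : Tendsto (fun i => endDist r x U W μtar (u i) (b i)) l (𝓝 q)) :
    endDist r x U W μtar v β ≤ q :=
  have (i : ι) := isFiniteMeasure_metaAction_discreteVarifold (x := x) (U := U) hr
    (flowMap (u i) 1) fun y => sq_nonneg (b i y)
  hW.dualDist_le_of_tendsto _ _ (fun ω =>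
    hV.tendsto_integral_metaAction hM huv hr (hW.continuous ω) hb) hq

theorem reducedCost_le_of_tendsto [IsFiniteMeasure μtar] (hr : ∀ i, 0 < r i)
    (hW : EmbedsCb (X := VSpace n d) W) (hγ : 0 ≤ γ) (hlam : 0 < lam) {v : L2Time V}
    {β : Eucl n → ℝ} {M m : ℝ} (hM : ∀ i, ‖u i‖ ≤ M) (huv : TendstoWeakly u l v)
    (hb : ∀ a ∈ atoms x, Tendsto (fun i => b i a) l (𝓝 (β a)))
    (hm : Tendsto (fun i => reducedCost r x U W γ lam μtar (u i) (b i)) l (𝓝 m)) :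
    reducedCost r x U W γ lam μtar v β ≤ m := by
  have hr₀ (i) : 0 ≤ r i := (hr i).le
  have hD (i : ι) : 0 ≤ endDist r x U W μtar (u i) (b i) := endDist_nonneg (u i) hr₀ hW (b i)
  obtain ⟨p, hp⟩ := exists_tendsto_of_eventually_mem_Icc l (f := fun i => ‖u i‖) (a := 0) (b := M)
    (Eventually.of_forall fun i => ⟨norm_nonneg _, hM i⟩)
  obtain ⟨q, hq⟩ := exists_tendsto_of_eventually_mem_Icc l
    (f := fun i => endDist r x U W μtar (u i) (b i)) (a := 0) (b := √(2 * (m + 1) / lam)) <| by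
    filter_upwards [hm.eventually (gt_mem_nhds (lt_add_one m))] with i hi
    refine ⟨hD i, Real.le_sqrt_of_sq_le ((le_div_iff₀' hlam).2 ?_)⟩
    linarith [hV.mul_sq_endDist_le_reducedCost (W := W) (x := x) (U := U) (μtar := μtar)
      (lam := lam) hr hγ (u i) (b i)]
  have hterm : ∀ a ∈ atoms x,
      Tendsto (fun i => 2 * γ * ((b i a - 1) ^ 2 / flowTime r x U (u i) a)) l
        (𝓝 (2 * γ * ((β a - 1) ^ 2 / flowTime r x U v a))) := fun a ha =>
    ((((hb a ha).sub_const 1).pow 2).div (hV.tendsto_flowTime hM huv hr ha)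
      (hV.flowTime_pos v hr ha).ne').const_mul _
  have hlim := tendsto_nhds_unique hm ((((hp.pow 2).const_mul (1 / 2)).add
    (tendsto_finsetSum _ hterm)).add ((hq.pow 2).const_mul (lam / 2)))
  rw [hlim, reducedCost]
  gcongr
  · exact huv.norm_le hp
  · exact endDist_nonneg v hr₀ hW β
  · exact hV.endDist_le_of_tendsto l hr₀ hW hM huv hb hq

theorem exists_forall_reducedCost_le [CompleteSpace V] [IsFiniteMeasure μtar] (hr : ∀ i, 0 < r i)
    (hW : EmbedsCb (X := VSpace n d) W) (hγ : 0 < γ) (hlam : 0 < lam) :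
    ∃ (v : L2Time V) (β : Eucl n → ℝ), ∀ (v' : L2Time V) (β' : Eucl n → ℝ),
      reducedCost r x U W γ lam μtar v β ≤ reducedCost r x U W γ lam μtar v' β' := by
  let F (z : L2Time V × (Eucl n → ℝ)) : ℝ := reducedCost r x U W γ lam μtar z.1 z.2
  have hbdd : BddBelow (range F) := ⟨0, forall_mem_range.2 fun z =>
    le_trans (by positivity) (hV.half_sq_norm_le_reducedCost hr hγ.le hlam.le z.1 z.2)⟩
  obtain ⟨m, hm_anti, hm, hmF⟩ := exists_seq_tendsto_sInf (range_nonempty F) hbdd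
  choose z hz using hmF
  have hC (k : ℕ) : F (z k) ≤ F (z 0) := by simpa only [hz] using hm_anti k.zero_le
  have hlim : Tendsto (fun k => F (z k)) (hyperfilter ℕ) (𝓝 (sInf (range F))) := by
    simpa only [hz] using hm.mono_left Nat.hyperfilter_le_atTop
  have hM (k : ℕ) := hV.norm_le_sqrt_of_reducedCost_le hr hγ.le hlam.le (z k).1 (z k).2 (hC k)
  obtain ⟨v, β, huv, hb⟩ :=
    hV.exists_tendsto_of_forall_reducedCost_le (hyperfilter ℕ) hr hγ hlam.le hC
  have hle := hV.reducedCost_le_of_tendsto _ hr hW hγ.le hlam hM huv hb hlim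
  exact ⟨v, β, fun v' β' => hle.trans (csInf_le hbdd ⟨(v', β'), rfl⟩)⟩

end EmbedsC11

end Existence

end

theorem theorem3_general {n d : ℕ}
    {V : Type*} [NormedAddCommGroup V] [InnerProductSpace ℝ V] [CompleteSpace V]
    [RKHS ℝ V (Eucl n) (Eucl n)] {c : ℝ} (hV : EmbedsC11 V c)
    {W : Type*} [NormedAddCommGroup W] [InnerProductSpace ℝ W] [RKHS ℝ W (VSpace n d) ℝ]
    (hW : EmbedsCb (X := VSpace n d) W) {γ lam : ℝ} (hγ : 0 < γ) (hlam : 0 < lam)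
    {N : ℕ} (r : Fin N → ℝ) (hr : ∀ i, 0 < r i) (x : Fin N → Eucl n) (U : Fin N → OGrass n d)
    (μtar : Measure (VSpace n d)) [IsFiniteMeasure μtar] :
    ∃ (v : L2Time V) (η : L2Time (Lp ℝ 2 (weight (discreteVarifold r x U)))),
      (∀ t ∈ Icc (0 : ℝ) 1,
        ∀ᵐ y ∂(weight (discreteVarifold r x U)), 0 ≤ alphaTilde η t y) ∧
      ∀ (v' : L2Time V) (η' : L2Time (Lp ℝ 2 (weight (discreteVarifold r x U)))),
        relaxedCost W γ lam (discreteVarifold r x U) μtar v η ≤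
          relaxedCost W γ lam (discreteVarifold r x U) μtar v' η' := by
  obtain ⟨v, β, hmin⟩ := hV.exists_forall_reducedCost_le (μtar := μtar) hr hW hγ hlam
  obtain ⟨η, hη⟩ := hV.exists_isOptimalRate hr v fun y => |β y|
  refine ⟨v, η, fun t ht => ae_weight_discreteVarifold fun i =>
    hη.alphaTilde_nonneg hV hr (mem_atoms.2 ⟨i, rfl⟩) (abs_nonneg _) ht, fun v' η' => ?_⟩
  calc relaxedCost W γ lam (discreteVarifold r x U) μtar v η
      = reducedCost r x U W γ lam μtar v fun y => |β y| := hη.relaxedCost_eq hV hr γ lam μtar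
    _ ≤ reducedCost r x U W γ lam μtar v β := hV.reducedCost_abs_le v hr hγ.le β
    _ ≤ reducedCost r x U W γ lam μtar v' (alphaTilde η' 1) := hmin v' _
    _ ≤ relaxedCost W γ lam (discreteVarifold r x U) μtar v' η' :=
      hV.reducedCost_alphaTilde_le v' hr hγ.le η'

theorem theorem3 {n d : ℕ} (hn : 2 ≤ n) (hd : d ≤ n)
    {V : Type*} [NormedAddCommGroup V] [InnerProductSpace ℝ V] [CompleteSpace V]
    [RKHS ℝ V (Eucl n) (Eucl n)] (hV : EmbedsC20 (n := n) V)
    {W : Type*} [NormedAddCommGroup W] [InnerProductSpace ℝ W] [CompleteSpace W]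
    [RKHS ℝ W (VSpace n d) ℝ]
    (k : VSpace n d → VSpace n d → ℝ) (hk : ∀ z z', k z z' = RKHS.kernel W z z' 1)
    (hk_nonneg : ∀ z z', 0 ≤ k z z') (hk_pos : ∀ z, 0 < k z z)
    (hW : EmbedsC10 (n := n) (d := d) W)
    {γ lam : ℝ} (hγ : 0 < γ) (hlam : 0 < lam)
    {N : ℕ} (r : Fin N → ℝ) (hr : ∀ i, 0 < r i) (x : Fin N → Eucl n) (U : Fin N → OGrass n d)
    (μ : Measure (VSpace n d)) (hμ : μ = discreteVarifold r x U)
    (μtar : Measure (VSpace n d)) [IsFiniteMeasure μtar] :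
    ∃ (v : L2Time V) (η : L2Time (Lp ℝ 2 (weight μ))),
      (∀ t ∈ Icc (0 : ℝ) 1, ∀ᵐ y ∂(weight μ), 0 ≤ alphaTilde η t y) ∧
      ∀ (v' : L2Time V) (η' : L2Time (Lp ℝ 2 (weight μ))),
        relaxedCost W γ lam μ μtar v η ≤ relaxedCost W γ lam μ μtar v' η' := by
  subst hμ
  obtain ⟨c, hV⟩ := hV.exists_embedsC11
  exact theorem3_general hV hW.embedsCb hγ hlam r hr x U μtar
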